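/- Let $S$ be a scheme and let $X$ be an $S$-scheme. Write $X/\mathrm{Sch}_X$ for the category of pointed $X$-schemes, i.e. $X$-schemes $Y\to X$ equipped with a section $X\to Y$, with morphisms the $X$-morphisms compatible with the sections; coproducts in it are pushouts along the sections, written $\amalg_X$, and $X$ itself is a zero object. For a quasi-coherent $\mathcal O_X$-module $\mathcal F$ let $\mathrm{Nil}_X(\mathcal F)=\mathrm{Spec}_X(\mathcal O_X\oplus\mathcal F)$, where $\mathcal F\subset\mathcal O_X\oplus\mathcal F$ is an ideal of square zero, with its structure map to $X$ and the section given by the projection $\mathcal O_X\oplus\mathcal F\to\mathcal O_X$. This is a contravariant functor from $\mathrm{Qcoh}(\mathcal O_X)$ to $X/\mathrm{Sch}_X$. An abelian cogroup object of $X/\mathrm{Sch}_X$ is an object $Y$ for which $Y\amalg_X Y$ exists, together with a comultiplication $c:Y\to Y\amalg_X Y$ and an inverse $\iota:Y\to Y$ which, with the unique map $Y\to X$ as counit, satisfy the duals of the axioms of an abelian group object; morphisms are the morphisms compatible with the comultiplications (hence with the inverses). Theorem. (1) For every quasi-coherent $\mathcal F$ the coproduct $\mathrm{Nil}_X(\mathcal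 F)\amalg_X\mathrm{Nil}_X(\mathcal F)$ exists in $X/\mathrm{Sch}_X$, and the canonical map $\mathrm{Nil}_X(\mathcal F)\amalg_X\mathrm{Nil}_X(\mathcal F)\to\mathrm{Nil}_X(\mathcal F\oplus\mathcal F)$ induced by the two projections $\mathcal F\oplus\mathcal F\to\mathcal F$ is an isomorphism. Under this isomorphism, the addition $\mathcal F\oplus\mathcal F\to\mathcal F$ induces a comultiplication $c_{\mathcal F}$, and $-1:\mathcal F\to\mathcal F$ induces an inverse $\iota_{\mathcal F}$, which make $\mathrm{Nil}_X(\mathcal F)$ an abelian cogroup object of $X/\mathrm{Sch}_X$, functorially in $\mathcal F$. (2) The functor $\mathcal F\mapsto(\mathrm{Nil}_X(\mathcal F),c_{\mathcal F},\iota_{\mathcal F})$ is an equivalence of categories from $\mathrm{Qcoh}(\mathcal O_X)^{op}$ to the category of abelian cogroup objects of $X/\mathrm{Sch}_X$ whose structure map $Y\to X$ is separated. -/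

import Mathlib

open CategoryTheory Limits AlgebraicGeometry Opposite TopologicalSpace

universe u v w

noncomputable section

/-! ### Abelian cogroup objects -/

section Cogroup

variable {C : Type w} [Category.{v} C]

/-- An abelian cogroup structure on an object `Y` of a category with an initial object, with respect
to the monoidal structure given by the coproduct; only the coproduct `Y ⨿ Y` is required to exist.
Coassociativity is expressed by saying that, for every `T`, the operation
`f * g = comul ≫ [f, g]` on `Y ⟶ T` is associative. If the triple coproducts exist, this is
the equality of the two maps from `Y` to `Y ⨿ Y ⨿ Y`, see `AbCogroupObj.coassoc_iff`. -/
class AbCogroupObj [HasInitial C] (Y : C) [HasBinaryCoproduct Y Y] where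
  /-- the comultiplication -/
  comul : Y ⟶ Y ⨿ Y
  /-- the counit -/
  counit : Y ⟶ ⊥_ C
  /-- the inversion -/
  antipode : Y ⟶ Y
  coassoc : ∀ {T : C} (f g h : Y ⟶ T),
    comul ≫ coprod.desc (comul ≫ coprod.desc f g) h =
      comul ≫ coprod.desc f (comul ≫ coprod.desc g h)
  counit_left : comul ≫ coprod.desc (counit ≫ initial.to Y) (𝟙 Y) = 𝟙 Y
  counit_right : comul ≫ coprod.desc (𝟙 Y) (counit ≫ initial.to Y) = 𝟙 Y
  antipode_left : comul ≫ coprod.desc antipode (𝟙 Y) = counit ≫ initial.to Y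
  antipode_right : comul ≫ coprod.desc (𝟙 Y) antipode = counit ≫ initial.to Y
  cocomm : comul ≫ coprod.desc coprod.inr coprod.inl = comul

lemma AbCogroupObj.coassoc_iff {Y : C} [HasBinaryCoproduct Y Y]
    [HasBinaryCoproduct Y (Y ⨿ Y)] (c : Y ⟶ Y ⨿ Y) :
    (∀ {T : C} (f g h : Y ⟶ T), c ≫ coprod.desc (c ≫ coprod.desc f g) h =
      c ≫ coprod.desc f (c ≫ coprod.desc g h)) ↔
    c ≫ coprod.desc (c ≫ coprod.desc coprod.inl (coprod.inl ≫ coprod.inr))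
      (coprod.inr ≫ coprod.inr) = c ≫ coprod.map (𝟙 Y) c := by
  constructor
  · intro h
    rw [h]
    congr 1
    apply coprod.hom_ext
    · rw [coprod.inl_desc, coprod.inl_map, Category.id_comp]
    · rw [coprod.inr_desc, coprod.inr_map, ← coprod.desc_comp, coprod.desc_inl_inr,
        Category.id_comp]
  · intro h T f g k
    have := congr($h ≫ coprod.desc f (coprod.desc g k))
    simp only [Category.assoc, coprod.desc_comp, coprod.inl_desc, coprod.inr_desc, coprod.map_desc,
      Category.id_comp] at this
    exact this

variable [HasInitial C]

variable (C) in
/-- The abelian cogroup objects of `C`. -/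
structure AbCogroup where
  /-- the underlying object -/
  pt : C
  [hasCoprod : HasBinaryCoproduct pt pt]
  [str : AbCogroupObj pt]

attribute [instance] AbCogroup.hasCoprod AbCogroup.str

namespace AbCogroup

/-- Morphisms of abelian cogroup objects: the morphisms compatible with the comultiplications
(they are automatically compatible with counits and inversions). -/
@[ext]
structure Hom (Y Z : AbCogroup C) where
  /-- the underlying morphism -/
  hom : Y.pt ⟶ Z.pt
  comul_map : AbCogroupObj.comul ≫ coprod.map hom hom = hom ≫ AbCogroupObj.comul

instance : Category (AbCogroup C) where
  Hom Y Z := Hom Y Z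
  id Y := ⟨𝟙 _, by simp⟩
  comp f g := ⟨f.hom ≫ g.hom, by
    rw [← coprod.map_map, ← Category.assoc, f.comul_map, Category.assoc, g.comul_map,
      Category.assoc]⟩

/-- The functor to abelian cogroup objects given by a functor `G`, abelian cogroup structures on
all `G.obj d`, and the compatibility of all `G.map φ` with the comultiplications. -/
def liftFunctor {D : Type*} [Category* D] (G : D ⥤ C)
    [∀ d, HasBinaryCoproduct (G.obj d) (G.obj d)] [∀ d, AbCogroupObj (G.obj d)]
    (h : ∀ {d e : D} (φ : d ⟶ e),
      AbCogroupObj.comul ≫ coprod.map (G.map φ) (G.map φ) = G.map φ ≫ AbCogroupObj.comul) :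
    D ⥤ AbCogroup C where
  obj d := ⟨G.obj d⟩
  map φ := ⟨G.map φ, h φ⟩
  map_id d := Hom.ext (G.map_id d)
  map_comp φ ψ := Hom.ext (G.map_comp φ ψ)

end AbCogroup

end Cogroup

namespace AlgebraicGeometry

variable {X : Scheme.{u}}

/-! ### Quasi-coherent modules -/

lemma modules_map_map (F : X.Modules) {U V W : X.Opens} (h : W ≤ V) (h' : V ≤ U) (t : Γ(F, U)) :
    F.presheaf.map (homOfLE h).op (F.presheaf.map (homOfLE h').op t) =
      F.presheaf.map (homOfLE (h.trans h')).op t := by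
  rw [← ConcreteCategory.comp_apply, ← F.presheaf.map_comp]; rfl

lemma modules_map_self (F : X.Modules) {U : X.Opens} (h : U ≤ U) (t : Γ(F, U)) :
    F.presheaf.map (homOfLE h).op t = t := by
  have : (homOfLE h).op = 𝟙 (op U) := rfl
  rw [this, F.presheaf.map_id]; rfl

lemma smul_restrict_fromSpec (F : X.Modules) {U : X.Opens} (hU : IsAffineOpen U) (f : Γ(X, U))
    (V : (Spec Γ(X, U)).Opens) (h : hU.fromSpec ''ᵁ V ≤ U) (x : Γ(F.restrict hU.fromSpec, V)) :
    (F.restrictAppIso hU.fromSpec V).hom (f • x) =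
      X.presheaf.map (homOfLE h).op f • (F.restrictAppIso hU.fromSpec V).hom x := by
  rw [Scheme.Modules.smul_Spec_def]
  rw [Scheme.Modules.smul_restrictAppIso_hom_apply]
  have : (Scheme.ΓSpecIso Γ(X, U)).inv ≫ (Spec Γ(X, U)).presheaf.map V.leTop.op ≫
      (hU.fromSpec.appIso V).inv = X.presheaf.map (homOfLE h).op := by
    rw [← Category.assoc, Iso.comp_inv_eq, Scheme.Hom.appIso_hom', Scheme.Hom.map_appLE,
      Scheme.Hom.appLE, hU.fromSpec_app_of_le _ le_rfl]
    have e : X.presheaf.map (homOfLE (le_refl U)).op = 𝟙 _ := X.presheaf.map_id _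
    rw [e, Category.id_comp, Category.assoc, ← Functor.map_comp]
    rfl
  rw [← this]
  rfl

/-- For `F` quasi-coherent, `U` affine and `f` in `Γ(X, U)`, the module `Γ(F, D(f))` is the
localization of `Γ(F, U)` at `f`. -/
lemma exists_and_eq_zero (F : X.Modules) [F.IsQuasicoherent] {U : X.Opens} (hU : IsAffineOpen U)
    (f : Γ(X, U)) :
    (∀ s : Γ(F, X.basicOpen f), ∃ (n : ℕ) (t : Γ(F, U)),
      F.presheaf.map (homOfLE (X.basicOpen_le f)).op t =
        (X.presheaf.map (homOfLE (X.basicOpen_le f)).op f) ^ n • s) ∧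
    (∀ t : Γ(F, U), F.presheaf.map (homOfLE (X.basicOpen_le f)).op t = 0 →
      ∃ n : ℕ, f ^ n • t = 0) := by
  have h := (isIso_fromTildeΓ_iff_isLocalizing (F.restrict hU.fromSpec)).mp inferInstance f
  have h2 := h.surj
  have h3 := @h.exists_of_eq
  have e1 : hU.fromSpec ''ᵁ ⊤ = U := by simp
  let D : (Spec Γ(X, U)).Opens := PrimeSpectrum.basicOpen f
  have e2 : hU.fromSpec ''ᵁ D = X.basicOpen f := hU.fromSpec_image_basicOpen f
  have e3 : hU.fromSpec ''ᵁ D ≤ U := e2 ▸ X.basicOpen_le f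
  have e4 : hU.fromSpec ''ᵁ D ≤ hU.fromSpec ''ᵁ ⊤ := e3.trans e1.ge
  constructor
  · intro s
    obtain ⟨⟨t, ⟨_, n, rfl⟩⟩, ht⟩ := h2 (F.presheaf.map (homOfLE e2.le).op s)
    refine ⟨n, F.presheaf.map (homOfLE e1.ge).op t, ?_⟩
    have ht' : X.presheaf.map (homOfLE e3).op (f ^ n) • (F.presheaf.map (homOfLE e2.le).op s) =
      F.presheaf.map (homOfLE e4).op t := (smul_restrict_fromSpec F hU (f ^ n) D e3 _).symm.trans ht
    have := congr(F.presheaf.map (homOfLE e2.ge).op $ht')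
    rw [Scheme.Modules.map_smul, modules_map_map, modules_map_self, map_pow, map_pow,
      ← ConcreteCategory.comp_apply, ← X.presheaf.map_comp] at this
    erw [modules_map_map F e2.ge e4 t] at this
    erw [modules_map_map F]
    exact this.symm
  · intro t ht
    obtain ⟨⟨_, n, rfl⟩, hn⟩ := h3 (x₁ := F.presheaf.map (homOfLE e1.le).op t) (x₂ := 0) (by
      rw [map_zero]
      change F.presheaf.map (homOfLE e4).op _ = 0
      rw [modules_map_map]
      have := congr(F.presheaf.map (homOfLE e2.le).op $ht)
      rwa [modules_map_map, map_zero] at this)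
    refine ⟨n, ?_⟩
    have ht' : X.presheaf.map (homOfLE e1.le).op (f ^ n) • (F.presheaf.map (homOfLE e1.le).op t) =
      0 := (smul_restrict_fromSpec F hU (f ^ n) _ e1.le _).symm.trans (hn.trans (smul_zero _))
    have := congr(F.presheaf.map (homOfLE e1.ge).op $ht')
    rw [Scheme.Modules.map_smul, modules_map_map, modules_map_self, map_zero,
      ← ConcreteCategory.comp_apply, ← X.presheaf.map_comp] at this
    have e : (homOfLE e1.le).op ≫ (homOfLE e1.ge).op = 𝟙 (op U) := rfl
    rw [e, X.presheaf.map_id] at this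
    exact this

lemma isQuasicoherent_of_affine (M : X.Modules)
    (h : ∀ (U : X.Opens) (hU : IsAffineOpen U), Nonempty (M.restrict hU.fromSpec).Presentation) :
    M.IsQuasicoherent := by
  refine SheafOfModules.QuasicoherentData.isQuasicoherent (M := M)
    { I := X.affineOpens
      X := fun U => U.1
      coversTop := ?_
      presentation := fun U => ?_ }
  · rw [Opens.coversTop_iff]
    exact iSup_affineOpens_eq_top X
  · have hU : IsAffineOpen U.1 := U.2
    let P := Scheme.Modules.presentationRestrict hU.isoSpec.hom (h U.1 hU).some
    let e := (Scheme.Modules.restrictFunctorComp hU.isoSpec.hom hU.fromSpec).symm ≪≫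
      Scheme.Modules.restrictFunctorCongr hU.isoSpec_hom_fromSpec
    let E : SheafOfModules (X.ringCatSheaf.over U.1) ≌
        SheafOfModules (U.1 : Scheme.{u}).ringCatSheaf := Scheme.Modules.overEquiv U.1
    have hI : IsIso (e.app M).hom := inferInstance
    let P' := @SheafOfModules.Presentation.ofIsIso.{u, u, u} _ _ _ _ _ _ _ _ (e.app M).hom hI P
    have : PreservesColimitsOfSize.{u, u} E.inverse :=
      E.symm.toAdjunction.leftAdjoint_preservesColimits
    let P'' := P'.map E.inverse (E.unitIso.app _)
    exact P''.ofIsIso ((E.inverse.mapIso ((Scheme.Modules.overFunctorEquiv U.1).app M).symm) ≪≫ (E.unitIso.app _).symm).hom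

lemma isQuasicoherent_biprod (F G : X.Modules) [F.IsQuasicoherent] [G.IsQuasicoherent] :
    (F ⊞ G).IsQuasicoherent := by
  refine isQuasicoherent_of_affine _ fun U hU => ?_
  let R := Scheme.Modules.restrictFunctor hU.fromSpec
  let T := tilde.functor Γ(X, U)
  have : PreservesBinaryBiproducts R := preservesBinaryBiproducts_of_preservesBinaryCoproducts R
  have : PreservesBinaryBiproducts T := preservesBinaryBiproducts_of_preservesBinaryCoproducts T
  have hF : IsIso (F.restrict hU.fromSpec).fromTildeΓ := inferInstance
  have hG : IsIso (G.restrict hU.fromSpec).fromTildeΓ := inferInstance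
  obtain ⟨M, ⟨eM⟩⟩ := isIso_fromTildeΓ_iff.mp hF
  obtain ⟨N, ⟨eN⟩⟩ := isIso_fromTildeΓ_iff.mp hG
  let e : tilde (M ⊞ N) ≅ R.obj (F ⊞ G) :=
    T.mapBiprod M N ≪≫ biprod.mapIso eM eN ≪≫ (R.mapBiprod F G).symm
  have hI : IsIso e.hom := inferInstance
  exact ⟨@SheafOfModules.Presentation.ofIsIso.{u, u, u} _ _ _ _ _ _ _ _ e.hom hI
    (presentationTilde.{u} (M ⊞ N) .univ (by simp) _ (Submodule.span_eq _))⟩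

/-- The category of quasi-coherent modules on a scheme. -/
abbrev Qcoh (X : Scheme.{u}) : Type (u + 1) :=
  ObjectProperty.FullSubcategory (C := X.Modules) fun F => F.IsQuasicoherent

namespace Qcoh

instance (F : Qcoh X) : F.obj.IsQuasicoherent := F.property

/-- The direct sum `F ⊕ F`. -/
def double (F : Qcoh X) : Qcoh X := ⟨F.obj ⊞ F.obj, isQuasicoherent_biprod F.obj F.obj⟩

/-- The first projection `F ⊕ F ⟶ F`. -/
def fst (F : Qcoh X) : F.double ⟶ F := ObjectProperty.homMk biprod.fst

/-- The second projection `F ⊕ F ⟶ F`. -/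
def snd (F : Qcoh X) : F.double ⟶ F := ObjectProperty.homMk biprod.snd

/-- The addition `F ⊕ F ⟶ F`. -/
def add (F : Qcoh X) : F.double ⟶ F := ObjectProperty.homMk (biprod.desc (𝟙 F.obj) (𝟙 F.obj))

/-- Multiplication by `-1` on `F`. -/
def neg (F : Qcoh X) : F ⟶ F := ObjectProperty.homMk (-𝟙 F.obj)

end Qcoh

/-! ### The quasi-coherent algebra `𝒪_X ⊕ F` -/

/-- The right action of `Γ(X, U)` on `Γ(F, U)`, which is the same as the left action. -/
abbrev modOp (F : X.Modules) (U : X.Opens) : Module (Γ(X, U))ᵐᵒᵖ Γ(F, U) :=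
  Module.compHom _ ((RingEquiv.toOpposite Γ(X, U)).symm : (Γ(X, U))ᵐᵒᵖ →+* Γ(X, U))

attribute [local instance] modOp

lemma modOp_isCentralScalar (F : X.Modules) (U : X.Opens) :
    IsCentralScalar Γ(X, U) Γ(F, U) := ⟨fun _ _ => rfl⟩

attribute [local instance] modOp_isCentralScalar

section
variable {R S M N : Type*} [CommRing R] [CommRing S] [AddCommGroup M] [AddCommGroup N]
  [Module R M] [Module S N] [Module Rᵐᵒᵖ M] [Module Sᵐᵒᵖ N] [IsCentralScalar R M]
  [IsCentralScalar S N]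

/-- The ring homomorphism `R ⊕ M ⟶ S ⊕ N`, `(r, m) ↦ (φ r, ψ m)`, of trivial square-zero extensions,
where `ψ` is linear over `φ`. -/
def tsMap (φ : R →+* S) (ψ : M →+ N) (h : ∀ r m, ψ (r • m) = φ r • ψ m) :
    TrivSqZeroExt R M →+* TrivSqZeroExt S N where
  toFun a := (φ a.fst, ψ a.snd)
  map_one' := TrivSqZeroExt.ext (map_one φ) (map_zero ψ)
  map_mul' _ _ := TrivSqZeroExt.ext (map_mul φ _ _) <|
    (map_add ψ _ _).trans (congr_arg₂ (· + ·) (h _ _)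
      ((congr_arg ψ (op_smul_eq_smul _ _)).trans ((h _ _).trans (op_smul_eq_smul _ _).symm)))
  map_zero' := TrivSqZeroExt.ext (map_zero φ) (map_zero ψ)
  map_add' _ _ := TrivSqZeroExt.ext (map_add φ _ _) (map_add ψ _ _)

lemma isLocalizationAway_tsMap (φ : R →+* S) (ψ : M →+ N) (h : ∀ r m, ψ (r • m) = φ r • ψ m)
    (f : R) (h₀ : IsUnit (φ f)) (h₁ : ∀ s, ∃ (n : ℕ) (a : R), s * φ f ^ n = φ a)
    (h₂ : ∀ a b, φ a = φ b → ∃ n : ℕ, f ^ n * a = f ^ n * b)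
    (h₃ : ∀ s, ∃ (n : ℕ) (t : M), ψ t = φ f ^ n • s)
    (h₄ : ∀ t, ψ t = 0 → ∃ n : ℕ, f ^ n • t = 0) :
    letI := (tsMap φ ψ h).toAlgebra
    IsLocalization.Away (TrivSqZeroExt.inl f : TrivSqZeroExt R M) (TrivSqZeroExt S N) := by
  let := (tsMap φ ψ h).toAlgebra
  have hmap (a : TrivSqZeroExt R M) :
      algebraMap (TrivSqZeroExt R M) (TrivSqZeroExt S N) a = .inl (φ a.fst) + .inr (ψ a.snd) :=
    TrivSqZeroExt.ext (add_zero _).symm (zero_add _).symm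
  have hf : algebraMap (TrivSqZeroExt R M) (TrivSqZeroExt S N) (.inl f) = .inl (φ f) := by
    simp [hmap]
  refine IsLocalization.Away.mk _ (hf ▸ h₀.map (TrivSqZeroExt.inlHom S N)) ?_ ?_
  · intro s
    obtain ⟨n, a, ha⟩ := h₁ s.fst
    obtain ⟨m, t, ht⟩ := h₃ s.snd
    refine ⟨n + m, .inl (f ^ m * a) + .inr (f ^ n • t), ?_⟩
    rw [hf, hmap, TrivSqZeroExt.inl_pow]
    ext
    · simp [← ha, pow_add]
      ring
    · simp only [h, ht, pow_add, mul_smul, map_pow, TrivSqZeroExt.snd_mul, TrivSqZeroExt.snd_add,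
        TrivSqZeroExt.snd_inl, TrivSqZeroExt.snd_inr, TrivSqZeroExt.fst_inl, smul_zero, zero_add,
        op_smul_eq_smul]
  · intro a b hab
    rw [hmap, hmap] at hab
    have h1 : φ a.fst = φ b.fst := by simpa using congr_arg TrivSqZeroExt.fst hab
    have h2 : ψ a.snd = ψ b.snd := by simpa using congr_arg TrivSqZeroExt.snd hab
    obtain ⟨n, hn⟩ := h₂ _ _ h1
    obtain ⟨m, hm⟩ := h₄ (a.snd - b.snd) (by rw [map_sub, h2, sub_self])
    rw [smul_sub, sub_eq_zero] at hm
    refine ⟨n + m, ?_⟩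
    rw [TrivSqZeroExt.inl_pow]
    ext
    · simp only [TrivSqZeroExt.fst_mul, TrivSqZeroExt.fst_inl, pow_add]
      linear_combination f ^ m * hn
    · simp [pow_add, mul_smul, hm]
end

/-- The ring `(𝒪_X ⊕ F)(U)`, in which `(a, m) (b, n) = (a b, a n + b m)`. -/
def nilRing (F : X.Modules) (U : X.Opens) : CommRingCat.{u} :=
  .of (TrivSqZeroExt Γ(X, U) Γ(F, U))

lemma nilRing_hom_ext {A : CommRingCat.{u}} {F : X.Modules} {U : X.Opens} {f g : A ⟶ nilRing F U}
    (h₁ : ∀ a, TrivSqZeroExt.fst (f a) = TrivSqZeroExt.fst (g a))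
    (h₂ : ∀ a, TrivSqZeroExt.snd (f a) = TrivSqZeroExt.snd (g a)) : f = g :=
  CommRingCat.hom_ext <| RingHom.ext fun a => TrivSqZeroExt.ext (h₁ a) (h₂ a)

/-- The presheaf of rings `𝒪_X ⊕ F` on `X`. -/
def nilPresheaf (F : X.Modules) : X.Opensᵒᵖ ⥤ CommRingCat.{u} where
  obj U := nilRing F U.unop
  map {U V} i := CommRingCat.ofHom (tsMap (M := Γ(F, U.unop)) (N := Γ(F, V.unop))
    (X.presheaf.map i).hom (F.presheaf.map i).hom fun r m => F.map_smul i.unop r m)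
  map_id U := nilRing_hom_ext
    (fun a => congr($(X.presheaf.map_id U) a.fst)) (fun a => congr($(F.presheaf.map_id U) a.snd))
  map_comp i j := nilRing_hom_ext
    (fun a => congr($(X.presheaf.map_comp i j) a.fst))
    (fun a => congr($(F.presheaf.map_comp i j) a.snd))

/-- The inclusion `𝒪_X ⟶ 𝒪_X ⊕ F`. -/
def nilInl (F : X.Modules) : X.presheaf ⟶ nilPresheaf F where
  app U := CommRingCat.ofHom (TrivSqZeroExt.inlHom Γ(X, U.unop) Γ(F, U.unop))
  naturality _ _ i := nilRing_hom_ext (fun _ => rfl)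
    (fun _ => (map_zero (F.presheaf.map i).hom).symm)

/-- The projection `𝒪_X ⊕ F ⟶ 𝒪_X`. -/
def nilFst (F : X.Modules) : nilPresheaf F ⟶ X.presheaf where
  app U := CommRingCat.ofHom (TrivSqZeroExt.fstHom Γ(X, U.unop) Γ(X, U.unop) Γ(F, U.unop)).toRingHom
  naturality _ _ _ := rfl

/-- The map `𝒪_X ⊕ F ⟶ 𝒪_X ⊕ G` induced by a morphism `F ⟶ G`. -/
def nilPresheafMap {F G : X.Modules} (φ : F ⟶ G) : nilPresheaf F ⟶ nilPresheaf G where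
  app U := CommRingCat.ofHom (tsMap (R := Γ(X, U.unop)) (M := Γ(F, U.unop)) (N := Γ(G, U.unop))
    (RingHom.id _) (φ.app U.unop).hom fun r m => φ.app_smul r m)
  naturality _ _ i := nilRing_hom_ext (fun _ => rfl)
    (fun a => congr($(φ.mapPresheaf.naturality i) a.snd))

lemma nilInl_nilFst (F : X.Modules) : nilInl F ≫ nilFst F = 𝟙 _ := rfl

lemma nilPresheafMap_id (F : X.Modules) : nilPresheafMap (𝟙 F) = 𝟙 _ := rfl

lemma nilPresheafMap_comp {F G H : X.Modules} (φ : F ⟶ G) (ψ : G ⟶ H) :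
    nilPresheafMap (φ ≫ ψ) = nilPresheafMap φ ≫ nilPresheafMap ψ := rfl

lemma nilInl_nilPresheafMap {F G : X.Modules} (φ : F ⟶ G) :
    nilInl F ≫ nilPresheafMap φ = nilInl G :=
  NatTrans.ext <| funext fun U => nilRing_hom_ext (fun _ => rfl)
    (fun _ => map_zero (φ.app U.unop).hom)

lemma nilPresheafMap_nilFst {F G : X.Modules} (φ : F ⟶ G) :
    nilPresheafMap φ ≫ nilFst G = nilFst F := rfl

open Scheme.AffineZariskiSite

/-- `𝒪_X ⊕ F` is a quasi-coherent algebra: `(𝒪_X ⊕ F)(D(f))` is the localization of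
`(𝒪_X ⊕ F)(U)` at `f`, for all affine opens `U` and all `f` in `Γ(X, U)`. -/
lemma coequifibered_nilInl (F : X.Modules) [F.IsQuasicoherent] :
    ((toOpensFunctor X).op.whiskerLeft (nilInl F)).Coequifibered := by
  refine coequifibered_iff_forall_isLocalizationAway.mpr fun U f ↦ ?_
  obtain ⟨h₃, h₄⟩ := exists_and_eq_zero F U.2 f
  have hloc : IsLocalization.Away f Γ(X, X.basicOpen f) := U.2.isLocalization_basicOpen f
  exact isLocalizationAway_tsMap (M := Γ(F, U.1)) (N := Γ(F, X.basicOpen f))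
    (X.presheaf.map (homOfLE (X.basicOpen_le f)).op).hom
    (F.presheaf.map (homOfLE (X.basicOpen_le f)).op).hom (fun r m => F.map_smul _ r m) f
    (IsLocalization.Away.algebraMap_isUnit (S := Γ(X, X.basicOpen f)) f)
    (IsLocalization.Away.surj f) (fun _ _ => IsLocalization.Away.exists_of_eq f) h₃ h₄

/-! ### The nilpotent thickening of `X` by `F` -/

/-- The affine schemes `Spec (𝒪_X ⊕ F)(U)` for `U` an affine open of `X`, with their maps to `U`
and the gluing along the inclusions `D(f) ⊆ U`. -/
def nilGluing (F : X.Modules) [F.IsQuasicoherent] : (directedCover X).RelativeGluingData :=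
  relativeGluingData (coequifibered_nilInl F)

instance (F : X.Modules) [F.IsQuasicoherent] :
    ((nilGluing F).functor ⋙ Scheme.forget).IsLocallyDirected :=
  Scheme.Cover.RelativeGluingData.instIsLocallyDirectedI₀CompFunctorForgetOfIsThin ..

/-- `Nil_X(F)`, the relative spectrum over `X` of the quasi-coherent algebra `𝒪_X ⊕ F`. -/
def nilScheme (F : X.Modules) [F.IsQuasicoherent] : Scheme.{u} := (nilGluing F).glued

/-- The structure map `Nil_X(F) ⟶ X`. -/
def nilToBase (F : X.Modules) [F.IsQuasicoherent] : nilScheme F ⟶ X := (nilGluing F).toBase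

/-- The morphism of diagrams `Spec ℬ(U) ⟶ Spec 𝒜(U)`, for `U` an affine open of `X`, that is
induced by a map `𝒜 ⟶ ℬ` of presheaves of rings. -/
def affineDiagramMap {𝒜 ℬ : X.Opensᵒᵖ ⥤ CommRingCat.{u}} (φ : 𝒜 ⟶ ℬ) :
    ((toOpensFunctor X).op ⋙ ℬ).rightOp ⋙ Scheme.Spec ⟶
      ((toOpensFunctor X).op ⋙ 𝒜).rightOp ⋙ Scheme.Spec :=
  Functor.whiskerRight (NatTrans.rightOp ((toOpensFunctor X).op.whiskerLeft φ)) Scheme.Spec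

lemma affineDiagramMap_comp {𝒜 ℬ 𝒞 : X.Opensᵒᵖ ⥤ CommRingCat.{u}} (φ : 𝒜 ⟶ ℬ) (ψ : ℬ ⟶ 𝒞) :
    affineDiagramMap (φ ≫ ψ) = affineDiagramMap ψ ≫ affineDiagramMap φ := by
  ext1; ext1 U
  exact Spec.map_comp _ _

lemma affineDiagramMap_id (𝒜 : X.Opensᵒᵖ ⥤ CommRingCat.{u}) :
    affineDiagramMap (𝟙 𝒜) = 𝟙 _ := by
  ext1; ext1 U
  exact Spec.map_id _

/-- The section `X ⟶ Nil_X(F)` of the structure map, induced by the projection `𝒪_X ⊕ F ⟶ 𝒪_X`.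
Here `X` is regarded as the colimit of its affine open subschemes. -/
def nilSection (F : X.Modules) [F.IsQuasicoherent] : X ⟶ nilScheme F :=
  (isColimitCocone X).map (colimit.cocone (nilGluing F).functor) (affineDiagramMap (nilFst F))

/-- The map `Nil_X(G) ⟶ Nil_X(F)` induced by a morphism `F ⟶ G`. -/
def nilMap {F G : X.Modules} [F.IsQuasicoherent] [G.IsQuasicoherent] (φ : F ⟶ G) :
    nilScheme G ⟶ nilScheme F :=
  (colimit.isColimit (nilGluing G).functor).map (colimit.cocone (nilGluing F).functor)
    (affineDiagramMap (nilPresheafMap φ))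

section

variable (F G : X.Modules) [F.IsQuasicoherent] [G.IsQuasicoherent]

variable {U : X.Opens} (hU : IsAffineOpen U)

/-- The inclusion of `Spec (𝒪_X ⊕ F)(U)` in `Nil_X(F)`, for `U` an affine open of `X`. -/
def nilι : Spec ((nilPresheaf F).obj (op U)) ⟶ nilScheme F :=
  colimit.ι (nilGluing F).functor ⟨U, hU⟩

lemma nilι_nilToBase :
    nilι F hU ≫ nilToBase F = Spec.map ((nilInl F).app (op U)) ≫ hU.fromSpec := by
  have h := Scheme.Cover.RelativeGluingData.ι_toBase (nilGluing F) ⟨U, hU⟩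
  exact h.trans ((Category.assoc _ _ _).trans rfl)

lemma fromSpec_nilSection :
    hU.fromSpec ≫ nilSection F = Spec.map ((nilFst F).app (op U)) ≫ nilι F hU :=
  (isColimitCocone X).ι_map (colimit.cocone (nilGluing F).functor) (affineDiagramMap (nilFst F))
    ⟨U, hU⟩

variable {F G} in
lemma nilι_nilMap (φ : F ⟶ G) :
    nilι G hU ≫ nilMap φ = Spec.map ((nilPresheafMap φ).app (op U)) ≫ nilι F hU :=
  (colimit.isColimit (nilGluing G).functor).ι_map (colimit.cocone (nilGluing F).functor)
    (affineDiagramMap (nilPresheafMap φ)) ⟨U, hU⟩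

variable {F} in
lemma nil_hom_ext {T : Scheme.{u}} {f g : nilScheme F ⟶ T}
    (h : ∀ (U : X.Opens) (hU : IsAffineOpen U), nilι F hU ≫ f = nilι F hU ≫ g) : f = g :=
  colimit.hom_ext fun U => h U.1 U.2

lemma fromSpec_hom_ext {T : Scheme.{u}} {f g : X ⟶ T}
    (h : ∀ (U : X.Opens) (hU : IsAffineOpen U), hU.fromSpec ≫ f = hU.fromSpec ≫ g) : f = g :=
  (isColimitCocone X).hom_ext fun U => h U.1 U.2

lemma nilSection_nilToBase : nilSection F ≫ nilToBase F = 𝟙 X := by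
  refine fromSpec_hom_ext fun U hU => ?_
  rw [← Category.assoc, fromSpec_nilSection, Category.assoc, nilι_nilToBase, ← Category.assoc,
    ← Spec.map_comp, ← NatTrans.comp_app, nilInl_nilFst, NatTrans.id_app, Spec.map_id,
    Category.id_comp, Category.comp_id]

variable {F G} in
lemma nilMap_nilToBase (φ : F ⟶ G) : nilMap φ ≫ nilToBase F = nilToBase G := by
  refine nil_hom_ext fun U hU => ?_
  rw [← Category.assoc, nilι_nilMap, Category.assoc, nilι_nilToBase, ← Category.assoc,
    ← Spec.map_comp, ← NatTrans.comp_app, nilInl_nilPresheafMap, nilι_nilToBase]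

variable {F G} in
lemma nilSection_nilMap (φ : F ⟶ G) : nilSection G ≫ nilMap φ = nilSection F := by
  refine fromSpec_hom_ext fun U hU => ?_
  rw [← Category.assoc, fromSpec_nilSection, Category.assoc, nilι_nilMap, ← Category.assoc,
    ← Spec.map_comp, ← NatTrans.comp_app, nilPresheafMap_nilFst, fromSpec_nilSection]

lemma nilMap_id : nilMap (𝟙 F) = 𝟙 _ := by
  refine nil_hom_ext fun U hU => ?_
  rw [nilι_nilMap, nilPresheafMap_id, NatTrans.id_app, Spec.map_id, Category.id_comp,
    Category.comp_id]

variable {F G} in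
lemma nilMap_comp {H : X.Modules} [H.IsQuasicoherent] (φ : F ⟶ G) (ψ : G ⟶ H) :
    nilMap (φ ≫ ψ) = nilMap ψ ≫ nilMap φ := by
  refine nil_hom_ext fun U hU => ?_
  rw [nilι_nilMap, ← Category.assoc, nilι_nilMap, Category.assoc, nilι_nilMap, nilPresheafMap_comp,
    NatTrans.comp_app, Spec.map_comp, Category.assoc]

instance isSeparated_nilToBase : IsSeparated (nilToBase F) := by
  have : IsAffineHom (nilToBase F) := by
    refine isAffineHom_of_forall_exists_isAffineOpen _ fun x => ?_
    obtain ⟨U, hxU⟩ := TopologicalSpace.Opens.mem_iSup.mp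
      ((iSup_affineOpens_eq_top X).ge (Set.mem_univ x))
    refine ⟨U, hxU, U.2, ?_⟩
    have h := (nilGluing F).toBase_preimage_eq_opensRange_ι U
    rw [Scheme.Opens.opensRange_ι] at h
    have : IsOpenImmersion (nilι F U.2) :=
      (nilGluing F).cover.map_prop U
    exact h ▸ isAffineOpen_opensRange (nilι F U.2)
  infer_instance

end

/-- The category `X/Sch_X`: schemes `Y` over `X` with a section of `Y ⟶ X`. -/
abbrev PointedOver (X : Scheme.{u}) := Under (Over.mk (𝟙 X))

/-- `Nil_X(F)` as an object of `X/Sch_X`. -/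
def nilPointed (F : X.Modules) [F.IsQuasicoherent] : PointedOver X :=
  Under.mk (Y := Over.mk (nilToBase F)) (Over.homMk (nilSection F) (nilSection_nilToBase F))

/-- The map `Nil_X(G) ⟶ Nil_X(F)` in `X/Sch_X` induced by a morphism `F ⟶ G`. -/
def nilPointedMap {F G : X.Modules} [F.IsQuasicoherent] [G.IsQuasicoherent] (φ : F ⟶ G) :
    nilPointed G ⟶ nilPointed F :=
  Under.homMk (U := nilPointed G) (V := nilPointed F)
    (Over.homMk (U := Over.mk (nilToBase G)) (V := Over.mk (nilToBase F)) (nilMap φ)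
      (nilMap_nilToBase φ))
    (Over.OverMorphism.ext (nilSection_nilMap φ))

/-- `F ↦ Nil_X(F)`, as a contravariant functor to `X/Sch_X`. -/
def nilFunctor (X : Scheme.{u}) : (Qcoh X)ᵒᵖ ⥤ PointedOver X where
  obj F := nilPointed F.unop.obj
  map φ := nilPointedMap φ.unop.hom
  map_id F := Under.UnderMorphism.ext (Over.OverMorphism.ext (nilMap_id F.unop.obj))
  map_comp φ ψ :=
    Under.UnderMorphism.ext (Over.OverMorphism.ext (nilMap_comp ψ.unop.hom φ.unop.hom))

/-- The abelian cogroup objects of `X/Sch_X` whose structure map to `X` is separated. -/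
abbrev CoAbSep (X : Scheme.{u}) :=
  ObjectProperty.FullSubcategory (C := AbCogroup (PointedOver X))
    fun Y => IsSeparated Y.pt.right.hom

/-- The canonical map `Nil_X(F) ⨿ Nil_X(F) ⟶ Nil_X(F ⊕ F)` in `X/Sch_X`. -/
def nilComparison (F : Qcoh X) [HasBinaryCoproduct ((nilFunctor X).obj (op F))
    ((nilFunctor X).obj (op F))] :
    (nilFunctor X).obj (op F) ⨿ (nilFunctor X).obj (op F) ⟶ (nilFunctor X).obj (op F.double) :=
  coprod.desc ((nilFunctor X).map F.fst.op) ((nilFunctor X).map F.snd.op)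

/-- The functor `F ↦ Nil_X(F)` to the abelian cogroup objects with separated structure map, for
given abelian cogroup structures on the `Nil_X(F)` that are preserved by the maps `Nil_X(φ)`. -/
def nilCogroupFunctor (X : Scheme.{u})
    [∀ F : (Qcoh X)ᵒᵖ, HasBinaryCoproduct ((nilFunctor X).obj F) ((nilFunctor X).obj F)]
    [∀ F : (Qcoh X)ᵒᵖ, AbCogroupObj ((nilFunctor X).obj F)]
    (h : ∀ {F G : (Qcoh X)ᵒᵖ} (φ : F ⟶ G),
      AbCogroupObj.comul ≫ coprod.map ((nilFunctor X).map φ) ((nilFunctor X).map φ) =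
        (nilFunctor X).map φ ≫ AbCogroupObj.comul) :
    (Qcoh X)ᵒᵖ ⥤ CoAbSep X :=
  ObjectProperty.lift _ (AbCogroup.liftFunctor (nilFunctor X) h)
    fun F => isSeparated_nilToBase F.unop.obj

end AlgebraicGeometry

end

noncomputable section

namespace AlgebraicGeometry

attribute [local instance] modOp modOp_isCentralScalar

/-! ### Morphisms out of a thickening with a retraction -/

section Retraction

variable {N X T : Scheme.{u}} {π : N ⟶ X} {σ : X ⟶ N}

/-! Write `π` for the structure map and `σ` for the section of `Nil_X(F)`. Since `F` is an ideal of
square zero, `σ` is surjective, so `π` and `σ` are inverse homeomorphisms and `π_* 𝒪` is `𝒪_X ⊕ F`.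
A pointed morphism `Nil_X(F) ⟶ T` therefore has a forced underlying map (`π` followed by the section
of `T`). On functions it is a ring map into `𝒪_X ⊕ F` whose first component is restriction along the
section of `T`. The only freedom is the second component, an `X`-derivation from `𝒪_T` to `F` along
the section. So pointed morphisms `Nil_X(F) ⟶ T` correspond to such derivations (`nilDer`,
`nilHom_ext`, `exists_nilHom`).

Part (1) is the additivity of derivations in `F`. A derivation into `F ⊕ F` is a pair of derivations
into `F`, so `Nil_X(F ⊕ F)` is the coproduct (`isColimitNilBiprod`). The comultiplication adds
derivations (`nilDer_nilComul`), and the cogroup axioms become the group laws of `Γ(F, W)`.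

For full faithfulness, a derivation from `𝒪_X ⊕ F` to `G` that vanishes on `𝒪_X` is an `𝒪_X`-linear
map `F ⟶ G` (`nilPointedMap_surjective`). Compatibility with the comultiplications is automatic by
naturality. Moreover the counit axioms alone determine the comultiplication of `Nil_X(F)`
(`eq_nilComul`).

For essential surjectivity, let `Y` be a separated cogroup object, and let `I`, `J` be the ideals of
the two axes `(1, σπ)`, `(σπ, 1)` in `Y ×_X Y`. Both axes factor through `V(IJ)`, so the
comultiplication gives a map `Y ⟶ V(IJ)`, and by the counit axioms this map is the diagonal
(`exists_diagonal_factorization`). If `f` and `g` vanish along the section, then `pr₂^* g` lies in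
`I` and `pr₁^* f` in `J`; their product vanishes on the diagonal, that is, `f g = 0`. So the
augmentation ideal has square zero, the section is surjective, `π` is affine, and `a = π^*σ^*a + (a
- π^*σ^*a)` identifies `Y` with `Nil_X` of its augmentation ideal. -/

lemma section_apply_of_surjective (hσ : σ ≫ π = 𝟙 X) (hs : Function.Surjective σ) (y : N) :
    σ (π y) = y := by
  obtain ⟨x, rfl⟩ := hs y
  have : π (σ x) = x := by rw [← Scheme.Hom.comp_apply, hσ]; rfl
  rw [this]

lemma preimage_preimage_of_surjective (hσ : σ ≫ π = 𝟙 X) (hs : Function.Surjective σ)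
    (V : N.Opens) : π ⁻¹ᵁ σ ⁻¹ᵁ V = V := by
  ext y
  change σ (π y) ∈ V ↔ y ∈ V
  rw [section_apply_of_surjective hσ hs]

/-- Surjectivity of `σ` settles the underlying maps. Every open of `N` is of the form `π⁻¹ U`, so it
suffices to compare the maps on sections over these. -/
lemma hom_ext_of_surjective (hσ : σ ≫ π = 𝟙 X) (hs : Function.Surjective σ) {f g : N ⟶ T}
    (h : σ ≫ f = σ ≫ g)
    (H : ∀ (V : T.Opens) (U : X.Opens) (e : π ⁻¹ᵁ U ≤ f ⁻¹ᵁ V) (e' : π ⁻¹ᵁ U ≤ g ⁻¹ᵁ V),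
      f.appLE V (π ⁻¹ᵁ U) e = g.appLE V (π ⁻¹ᵁ U) e') : f = g := by
  have hb : ∀ y, f y = g y := fun y => by
    obtain ⟨x, rfl⟩ := hs y
    rw [← Scheme.Hom.comp_apply, h, Scheme.Hom.comp_apply]
  refine Scheme.Hom.ext (TopCat.ext hb) fun V => ?_
  have e : f ⁻¹ᵁ V = g ⁻¹ᵁ V := by
    ext y
    change f y ∈ V ↔ g y ∈ V
    rw [hb]
  have e₁ : f ⁻¹ᵁ V = π ⁻¹ᵁ (σ ⁻¹ᵁ f ⁻¹ᵁ V) := (preimage_preimage_of_surjective hσ hs _).symm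
  have := congr($(H V _ e₁.ge (e₁.ge.trans e.le)) ≫
    N.presheaf.map (homOfLE (e.ge.trans e₁.le)).op)
  rw [Scheme.Hom.appLE_map, Scheme.Hom.appLE_map, Scheme.Hom.appLE_eq_app] at this
  exact this

/-- The underlying map has to be `π` followed by `t`, so a morphism is just a compatible family of
ring maps `c` lifting `t`. The point to check is that the stalk maps are local. -/
lemma exists_hom_of_surjective (hσ : σ ≫ π = 𝟙 X) (hs : Function.Surjective σ) (t : X ⟶ T)
    (c : ∀ V : T.Opens, Γ(T, V) ⟶ Γ(N, π ⁻¹ᵁ t ⁻¹ᵁ V))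
    (hc : ∀ (V W : T.Opens) (h : W ≤ V), c V ≫ N.presheaf.map (homOfLE
      (show π ⁻¹ᵁ t ⁻¹ᵁ W ≤ π ⁻¹ᵁ t ⁻¹ᵁ V from fun _ hx => h hx)).op =
        T.presheaf.map (homOfLE h).op ≫ c W)
    (hct : ∀ (V : T.Opens) (e : t ⁻¹ᵁ V ≤ σ ⁻¹ᵁ π ⁻¹ᵁ t ⁻¹ᵁ V), c V ≫ σ.appLE _ _ e = t.app V) :
    ∃ f : N ⟶ T, σ ≫ f = t ∧ ∀ (V : T.Opens) (e : π ⁻¹ᵁ t ⁻¹ᵁ V ≤ f ⁻¹ᵁ V),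
      f.appLE V (π ⁻¹ᵁ t ⁻¹ᵁ V) e = c V := by
  let f₀ : N.toPresheafedSpace.Hom T.toPresheafedSpace :=
    { base := π.base ≫ t.base
      c := { app V := c V.unop
             naturality V W i := (hc V.unop W.unop i.unop.le).symm } }
  have hb : ∀ x, σ (π x) = x := section_apply_of_surjective hσ hs
  have hb' : ∀ x, π (σ x) = x := fun x => by rw [← Scheme.Hom.comp_apply, hσ]; rfl
  have hle : ∀ W : X.Opens, W ≤ σ ⁻¹ᵁ π ⁻¹ᵁ W := fun W x hx => by
    change π (σ x) ∈ W
    rwa [hb']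
  -- If `c V z` is invertible at `y = σ (π y)`, pulling back along `σ` makes `t.app V z` invertible
  -- at `π y`; since `t` is a morphism of schemes, `z` is then invertible at the image point.
  have hloc : ∀ y, IsLocalHom (f₀.stalkMap y).hom := by
    intro y
    refine ⟨fun r hr => ?_⟩
    obtain ⟨V, hV, z, rfl⟩ := T.presheaf.exists_germ_eq r
    have h₁ : (ConcreteCategory.hom (f₀.stalkMap y)) (T.presheaf.germ V _ hV z) =
        N.presheaf.germ (π ⁻¹ᵁ t ⁻¹ᵁ V) y hV (c V z) :=
      PresheafedSpace.stalkMap_germ_apply f₀ V y hV z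
    have h₂ : y ∈ N.basicOpen (c V z) := (N.mem_basicOpen _ _ hV).mpr (h₁ ▸ hr)
    have h₃ : π y ∈ X.basicOpen (t.app V z) := by
      rw [← hct V (hle _), CommRingCat.comp_apply, Scheme.basicOpen_appLE]
      refine ⟨hV, ?_⟩
      change σ (π y) ∈ N.basicOpen (c V z)
      rwa [hb]
    rw [← Scheme.preimage_basicOpen] at h₃
    exact (T.mem_basicOpen _ _ hV).mp h₃
  let f : N ⟶ T := ⟨⟨f₀, hloc⟩⟩
  have happ : ∀ V, f.app V = c V := fun V => rfl
  refine ⟨f, ?_, fun V e => ?_⟩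
  · refine Scheme.Hom.ext (TopCat.ext fun x => congr_arg t (hb' x)) fun V => ?_
    rw [Scheme.Hom.comp_app, happ, ← hct V (hle _)]
    exact Category.assoc (c V) _ _
  · rw [← happ]
    exact Scheme.Hom.appLE_eq_app _

end Retraction

open Scheme.AffineZariskiSite

/-! ### Sections pulled back to a spectrum -/

section SpecSections

/-- The map `Γ(Z, V) ⟶ R` given by a morphism `Spec R ⟶ Z` that factors through `V`. -/
def specSections {R : CommRingCat.{u}} {Z : Scheme.{u}} (f : Spec R ⟶ Z) (V : Z.Opens)
    (e : ⊤ ≤ f ⁻¹ᵁ V) : Γ(Z, V) ⟶ R :=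
  f.appLE V ⊤ e ≫ (Scheme.ΓSpecIso R).hom

lemma specSections_comp {R S : CommRingCat.{u}} {Z : Scheme.{u}} (f : Spec R ⟶ Z) (V : Z.Opens)
    (e : ⊤ ≤ f ⁻¹ᵁ V) (φ : R ⟶ S) {g : Spec S ⟶ Z} (hg : Spec.map φ ≫ f = g) (e' : ⊤ ≤ g ⁻¹ᵁ V) :
    specSections f V e ≫ φ = specSections g V e' := by
  subst hg
  unfold specSections
  have h : f.appLE V ⊤ e ≫ (Spec.map φ).appTop = (Spec.map φ ≫ f).appLE V ⊤ e' := by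
    rw [Scheme.Hom.appTop, Scheme.Hom.app_eq_appLE]
    exact Scheme.Hom.appLE_comp_appLE _ _ _ _ _ _ _
  rw [Category.assoc, ← Scheme.ΓSpecIso_naturality, ← Category.assoc, h]

lemma appLE_specSections {R : CommRingCat.{u}} {Z T : Scheme.{u}} (f : Spec R ⟶ Z) (V : Z.Opens)
    (e : ⊤ ≤ f ⁻¹ᵁ V) (k : Z ⟶ T) (W : T.Opens) (e₁ : V ≤ k ⁻¹ᵁ W) {g : Spec R ⟶ T}
    (hg : f ≫ k = g) (e' : ⊤ ≤ g ⁻¹ᵁ W) :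
    k.appLE W V e₁ ≫ specSections f V e = specSections g W e' := by
  subst hg
  unfold specSections
  rw [← Category.assoc, Scheme.Hom.appLE_comp_appLE]

lemma map_specSections {R : CommRingCat.{u}} {Z : Scheme.{u}} (f : Spec R ⟶ Z) (V : Z.Opens)
    (e : ⊤ ≤ f ⁻¹ᵁ V) (W : Z.Opens) (h : V ≤ W) (e' : ⊤ ≤ f ⁻¹ᵁ W) :
    Z.presheaf.map (homOfLE h).op ≫ specSections f V e = specSections f W e' := by
  unfold specSections
  rw [← Category.assoc, Scheme.Hom.map_appLE]

lemma specSections_fromSpec {X : Scheme.{u}} {U : X.Opens} (hU : IsAffineOpen U)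
    (e : ⊤ ≤ hU.fromSpec ⁻¹ᵁ U) : specSections hU.fromSpec U e = 𝟙 _ := by
  unfold specSections Scheme.Hom.appLE
  rw [hU.fromSpec_app_self, Category.assoc, Category.assoc, ← Functor.map_comp_assoc]
  have h : (Spec Γ(X, U)).presheaf.map ((eqToHom hU.fromSpec_preimage_self).op ≫
      (homOfLE e).op) = 𝟙 _ := (Spec Γ(X, U)).presheaf.map_id (op ⊤)
  rw [h]
  exact (congr_arg _ (Category.id_comp _)).trans (Iso.inv_hom_id _)

end SpecSections

/-! ### The structure sheaf of `Nil_X(F)` -/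

section NilStructureSheaf

variable {X : Scheme.{u}} (F G : X.Modules) 

/-- As a presheaf of sets this is the product of `𝒪_X` and `F`, so gluing is done in each component.
-/
lemma isSheaf_nilPresheaf : TopCat.Presheaf.IsSheaf (nilPresheaf F) := by
  rw [TopCat.Presheaf.isSheaf_iff_isSheaf_comp (forget CommRingCat)]
  rw [TopCat.Presheaf.isSheaf_iff_isSheafUniqueGluing_types]
  intro ι U sf hsf
  have h₁ : TopCat.Presheaf.IsCompatible X.presheaf U
      (fun i => (show Γ(X, U i) from TrivSqZeroExt.fst (sf i))) := fun i j =>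
    congr_arg (TrivSqZeroExt.fst (R := Γ(X, U i ⊓ U j)) (M := Γ(F, U i ⊓ U j))) (hsf i j)
  have h₂ : TopCat.Presheaf.IsCompatible F.presheaf U
      (fun i => (show Γ(F, U i) from TrivSqZeroExt.snd (sf i))) := fun i j =>
    congr_arg (TrivSqZeroExt.snd (R := Γ(X, U i ⊓ U j)) (M := Γ(F, U i ⊓ U j))) (hsf i j)
  obtain ⟨a, ha, ha'⟩ := X.sheaf.existsUnique_gluing U _ h₁
  obtain ⟨m, hm, hm'⟩ := TopCat.Sheaf.existsUnique_gluing ⟨F.presheaf, F.isSheaf⟩ U _ h₂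
  refine ⟨((a, m) : TrivSqZeroExt Γ(X, iSup U) Γ(F, iSup U)),
    fun i => TrivSqZeroExt.ext (ha i) (hm i), fun b hb => TrivSqZeroExt.ext ?_ ?_⟩
  · exact ha' _ fun i => congr_arg (TrivSqZeroExt.fst (R := Γ(X, U i)) (M := Γ(F, U i))) (hb i)
  · exact hm' _ fun i => congr_arg (TrivSqZeroExt.snd (R := Γ(X, U i)) (M := Γ(F, U i))) (hb i)

variable [F.IsQuasicoherent] [G.IsQuasicoherent]

/-- Elements of `F` square to zero, hence lie in every prime of `𝒪_X ⊕ F`. A prime is thus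
determined by its first components and is fixed by the endomorphism `inl ∘ fst`. -/
lemma nilSection_surjective : Function.Surjective (nilSection F) := by
  intro y
  obtain ⟨i, z, rfl⟩ := (nilGluing F).cover.exists_eq y
  have hz : Spec.map ((nilFst F).app (op i.1)) (Spec.map ((nilInl F).app (op i.1)) z) = z := by
    refine PrimeSpectrum.ext (Ideal.ext fun (a : TrivSqZeroExt Γ(X, i.1) Γ(F, i.1)) => ?_)
    change (TrivSqZeroExt.inl a.fst : TrivSqZeroExt Γ(X, i.1) Γ(F, i.1)) ∈ z.asIdeal ↔
      a ∈ z.asIdeal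
    have h : (TrivSqZeroExt.inr a.snd : TrivSqZeroExt Γ(X, i.1) Γ(F, i.1)) ∈ z.asIdeal :=
      z.isPrime.mem_of_pow_mem 2 (by
        have h : (TrivSqZeroExt.inr a.snd : TrivSqZeroExt Γ(X, i.1) Γ(F, i.1)) ^ 2 = 0 := by
          rw [pow_two, TrivSqZeroExt.inr_mul_inr]
        exact h ▸ z.asIdeal.zero_mem)
    conv_rhs => rw [← TrivSqZeroExt.inl_fst_add_inr_snd_eq a]
    exact (Ideal.add_mem_iff_left _ h).symm
  refine ⟨i.2.fromSpec (Spec.map ((nilInl F).app (op i.1)) z), ?_⟩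
  rw [← Scheme.Hom.comp_apply, fromSpec_nilSection, Scheme.Hom.comp_apply, hz]
  rfl

instance isOpenImmersion_nilι {U : X.Opens} (hU : IsAffineOpen U) : IsOpenImmersion (nilι F hU) :=
  (nilGluing F).cover.map_prop ⟨U, hU⟩

lemma opensRange_nilι {U : X.Opens} (hU : IsAffineOpen U) :
    (nilι F hU).opensRange = nilToBase F ⁻¹ᵁ U := by
  have h := (nilGluing F).toBase_preimage_eq_opensRange_ι ⟨U, hU⟩
  rw [Scheme.Opens.opensRange_ι] at h
  exact h.symm

lemma top_le_nilι_preimage {U : X.Opens} (hU : IsAffineOpen U) :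
    ⊤ ≤ nilι F hU ⁻¹ᵁ nilToBase F ⁻¹ᵁ U := by
  rw [← opensRange_nilι F hU]
  simp

/-- The map `Γ(Nil_X(F), π⁻¹ U) ⟶ (𝒪_X ⊕ F)(U)` for `U` affine. -/
def nilAffineSections {U : X.Opens} (hU : IsAffineOpen U) :
    Γ(nilScheme F, nilToBase F ⁻¹ᵁ U) ⟶ (nilPresheaf F).obj (op U) :=
  specSections (nilι F hU) (nilToBase F ⁻¹ᵁ U) (top_le_nilι_preimage F hU)

instance isIso_nilAffineSections {U : X.Opens} (hU : IsAffineOpen U) :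
    IsIso (nilAffineSections F hU) := by
  have h₁ : IsIso ((nilι F hU).app (nilToBase F ⁻¹ᵁ U)) :=
    (nilι F hU).isIso_app _ (opensRange_nilι F hU).ge
  have h₂ : IsIso ((Spec ((nilPresheaf F).obj (op U))).presheaf.map
      (homOfLE (top_le_nilι_preimage F hU)).op) := by
    have : IsIso (homOfLE (top_le_nilι_preimage F hU)) := 
      ⟨homOfLE le_top, rfl, rfl⟩
    infer_instance
  unfold nilAffineSections specSections Scheme.Hom.appLE
  infer_instance

lemma nilAffineSections_naturality {U V : X.AffineZariskiSite} (i : U ⟶ V) :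
    (nilScheme F).presheaf.map (homOfLE (show nilToBase F ⁻¹ᵁ U.1 ≤ nilToBase F ⁻¹ᵁ V.1 from
      fun _ hx => toOpens_mono i.le hx)).op ≫ nilAffineSections F U.2 =
    nilAffineSections F V.2 ≫ (nilPresheaf F).map ((toOpensFunctor X).map i).op := by
  have h : Spec.map ((nilPresheaf F).map ((toOpensFunctor X).map i).op) ≫ nilι F V.2 =
      nilι F U.2 := colimit.w (nilGluing F).functor i
  have h : Spec.map ((nilPresheaf F).map ((toOpensFunctor X).map i).op) ≫ nilι F V.2 =
      nilι F U.2 := colimit.w (nilGluing F).functor i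
  have h' : nilToBase F ⁻¹ᵁ U.1 ≤ nilToBase F ⁻¹ᵁ V.1 := fun _ hx => toOpens_mono i.le hx
  have e : ⊤ ≤ nilι F U.2 ⁻¹ᵁ nilToBase F ⁻¹ᵁ V.1 := fun _ hx =>
    h' (top_le_nilι_preimage F U.2 hx)
  have h₁ := map_specSections (nilι F U.2) _ (top_le_nilι_preimage F U.2) _ h' e
  have h₂ := specSections_comp (nilι F V.2) _ (top_le_nilι_preimage F V.2) _ h e
  exact h₁.trans h₂.symm

/-- `π_* 𝒪` for `π : Nil_X(F) ⟶ X`. -/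
def nilPushforward : X.Opensᵒᵖ ⥤ CommRingCat.{u} :=
  (Opens.map (nilToBase F).base).op ⋙ (nilScheme F).presheaf

lemma isSheaf_nilPushforward : TopCat.Presheaf.IsSheaf (nilPushforward F) :=
  TopCat.Sheaf.pushforward_sheaf_of_sheaf _ (nilScheme F).sheaf.property

/-- The identification of `π_* 𝒪` with `𝒪_X ⊕ F` on affine opens. -/
def nilAffineSectionsIso :
    (toOpensFunctor X).op ⋙ nilPushforward F ≅ (toOpensFunctor X).op ⋙ nilPresheaf F :=
  NatIso.ofComponents (fun U => @asIso _ _ _ _ (nilAffineSections F U.unop.2)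
    (isIso_nilAffineSections F U.unop.2))
    fun i => nilAffineSections_naturality F i.unop

/-- The identification of `π_* 𝒪` with `𝒪_X ⊕ F` for `π : Nil_X(F) ⟶ X`. -/
def nilSections : nilPushforward F ≅ nilPresheaf F :=
  -- Affine opens form a basis and both sides are sheaves, so an isomorphism over affine opens
  -- extends to all opens.
  Functor.IsCoverDense.presheafIso (G := toOpensFunctor X) (K := Opens.grothendieckTopology X)
    (ℱ := ⟨nilPushforward F, isSheaf_nilPushforward F⟩)
    (ℱ' := ⟨nilPresheaf F, isSheaf_nilPresheaf F⟩) (nilAffineSectionsIso F)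

lemma nilSections_app_affine {U : X.Opens} (hU : IsAffineOpen U) :
    (nilSections F).hom.app (op U) = nilAffineSections F hU := by
  have := congr_app (Functor.IsCoverDense.sheafHom_restrict_eq (G := toOpensFunctor X)
    (K := Opens.grothendieckTopology X) (ℱ' := ⟨nilPresheaf F, isSheaf_nilPresheaf F⟩)
      (nilAffineSectionsIso F).hom) (op ⟨U, hU⟩)
  exact this

/-- Affine opens form a basis, so a map into a sheaf is known from its values there. This reduces
the compatibilities of `nilSections` with `π`, `σ` and `nilMap` to computations on `Spec (𝒪_X ⊕
F)(U)`. -/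
lemma presheafHom_ext_affine {𝒜 ℬ : X.Opensᵒᵖ ⥤ CommRingCat.{u}}
    (hℬ : TopCat.Presheaf.IsSheaf (X := X.toTopCat) ℬ) {φ ψ : 𝒜 ⟶ ℬ}
    (h : ∀ U : X.Opens, IsAffineOpen U → φ.app (op U) = ψ.app (op U)) : φ = ψ := by
  rw [← Functor.IsCoverDense.sheafHom_eq (toOpensFunctor X) (K := Opens.grothendieckTopology X)
    (ℱ' := ⟨ℬ, hℬ⟩) φ, ← Functor.IsCoverDense.sheafHom_eq (toOpensFunctor X)
      (K := Opens.grothendieckTopology X) (ℱ' := ⟨ℬ, hℬ⟩) ψ]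
  congr 1
  ext1
  ext1 U
  exact h _ U.unop.2

/-- The map `𝒪_X ⟶ π_* 𝒪`. -/
def nilToBaseSections : X.presheaf ⟶ nilPushforward F where
  app U := (nilToBase F).app U.unop
  naturality _ _ i := (nilToBase F).naturality i

lemma nilToBaseSections_nilSections :
    nilToBaseSections F ≫ (nilSections F).hom = nilInl F := by
  refine presheafHom_ext_affine (isSheaf_nilPresheaf F) fun U hU => ?_
  have e : ⊤ ≤ hU.fromSpec ⁻¹ᵁ U := hU.fromSpec_preimage_self.ge
  rw [NatTrans.comp_app, nilSections_app_affine F hU]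
  change (nilToBase F).app U ≫ nilAffineSections F hU = _
  rw [Scheme.Hom.app_eq_appLE]
  refine (appLE_specSections _ _ (top_le_nilι_preimage F hU) _ _ _
    (nilι_nilToBase F hU) (fun _ _ => e trivial)).trans ?_
  refine (specSections_comp _ _ e _ rfl _).symm.trans ?_
  rw [specSections_fromSpec, Category.id_comp]

lemma le_nilSection_preimage (U : X.Opens) : U ≤ nilSection F ⁻¹ᵁ nilToBase F ⁻¹ᵁ U := by
  rw [← Scheme.Hom.comp_preimage, nilSection_nilToBase]
  exact le_rfl

/-- The map `π_* 𝒪 ⟶ 𝒪_X` given by the section of `π`. -/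
def nilSectionSections : nilPushforward F ⟶ X.presheaf where
  app U := (nilSection F).appLE _ _ (le_nilSection_preimage F U.unop)
  naturality _ _ _ := (Scheme.Hom.map_appLE _ _ _).trans (Scheme.Hom.appLE_map _ _ _).symm

lemma nilSections_nilFst :
    (nilSections F).hom ≫ nilFst F = nilSectionSections F := by
  refine presheafHom_ext_affine X.sheaf.property fun U hU => ?_
  have e : ⊤ ≤ hU.fromSpec ⁻¹ᵁ U := hU.fromSpec_preimage_self.ge
  have e' : ⊤ ≤ (hU.fromSpec ≫ nilSection F) ⁻¹ᵁ nilToBase F ⁻¹ᵁ U :=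
    fun x hx => le_nilSection_preimage F U (e hx)
  rw [NatTrans.comp_app, nilSections_app_affine F hU]
  refine (specSections_comp _ _ (top_le_nilι_preimage F hU) _
    (fromSpec_nilSection F hU).symm e').trans ?_
  refine (appLE_specSections _ _ e _ _ (le_nilSection_preimage F U) rfl e').symm.trans ?_
  rw [specSections_fromSpec]
  exact Category.comp_id _

variable {F G} in
lemma nilMap_preimage (φ : F ⟶ G) (U : X.Opens) :
    nilMap φ ⁻¹ᵁ nilToBase F ⁻¹ᵁ U = nilToBase G ⁻¹ᵁ U := by
  rw [← Scheme.Hom.comp_preimage, nilMap_nilToBase]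

variable {F G} in
/-- The map `π_* 𝒪 ⟶ π_* 𝒪` given by `Nil_X(φ)`. -/
def nilMapSections (φ : F ⟶ G) : nilPushforward F ⟶ nilPushforward G where
  app U := (nilMap φ).appLE _ _ (nilMap_preimage φ U.unop).ge
  naturality _ _ _ := (Scheme.Hom.map_appLE _ _ _).trans (Scheme.Hom.appLE_map _ _ _).symm

variable {F G} in
lemma nilMapSections_nilSections (φ : F ⟶ G) :
    nilMapSections φ ≫ (nilSections G).hom = (nilSections F).hom ≫ nilPresheafMap φ := by
  refine presheafHom_ext_affine (isSheaf_nilPresheaf G) fun U hU => ?_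
  rw [NatTrans.comp_app, NatTrans.comp_app, nilSections_app_affine F hU,
    nilSections_app_affine G hU]
  have e : ⊤ ≤ (nilι G hU ≫ nilMap φ) ⁻¹ᵁ nilToBase F ⁻¹ᵁ U := by
    rw [Scheme.Hom.comp_preimage, nilMap_preimage]
    exact top_le_nilι_preimage G hU
  exact (appLE_specSections _ _ (top_le_nilι_preimage G hU) _ _ (nilMap_preimage φ U).ge rfl
    e).trans (specSections_comp _ _ _ _ (nilι_nilMap hU φ).symm e).symm

end NilStructureSheaf

/-! ### Pointed schemes over `X` -/

namespace PointedOver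

variable {X : Scheme.{u}}

/-- The underlying scheme. -/
def toScheme (T : PointedOver X) : Scheme.{u} := T.right.left

/-- The structure map. -/
def toBase (T : PointedOver X) : T.toScheme ⟶ X := T.right.hom

/-- The section. -/
def sec (T : PointedOver X) : X ⟶ T.toScheme := T.hom.left

lemma sec_toBase (T : PointedOver X) : T.sec ≫ T.toBase = 𝟙 X := Over.w T.hom

/-- The underlying morphism of schemes. -/
def homLeft {T T' : PointedOver X} (f : T ⟶ T') : T.toScheme ⟶ T'.toScheme := f.right.left

lemma homLeft_toBase {T T' : PointedOver X} (f : T ⟶ T') : homLeft f ≫ T'.toBase = T.toBase :=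
  Over.w f.right

lemma sec_homLeft {T T' : PointedOver X} (f : T ⟶ T') : T.sec ≫ homLeft f = T'.sec :=
  congr($(Under.w f).left)

lemma hom_ext {T T' : PointedOver X} {f g : T ⟶ T'} (h : homLeft f = homLeft g) : f = g :=
  Under.UnderMorphism.ext (Over.OverMorphism.ext h)

/-- A pointed scheme from a scheme with a structure map and a section. -/
def of {Y : Scheme.{u}} (p : Y ⟶ X) (s : X ⟶ Y) (h : s ≫ p = 𝟙 X) : PointedOver X :=
  Under.mk (Y := Over.mk p) (Over.homMk s h)

/-- A morphism of pointed schemes. -/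
def homOf {T T' : PointedOver X} (f : T.toScheme ⟶ T'.toScheme) (h₁ : f ≫ T'.toBase = T.toBase)
    (h₂ : T.sec ≫ f = T'.sec) : T ⟶ T' :=
  Under.homMk (Over.homMk f h₁) (Over.OverMorphism.ext h₂)

end PointedOver

open PointedOver

/-! ### Morphisms from `Nil_X(F)` as derivations -/

section Derivation

variable {X : Scheme.{u}} {F G : X.Modules} [F.IsQuasicoherent] [G.IsQuasicoherent]
  {T T' : PointedOver X}

variable (F) in
/-- The identification `Γ(Nil_X(F), π⁻¹ W) ⟶ (𝒪_X ⊕ F)(W)`. -/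
def nilSectionsAt (W : X.Opens) :
    Γ(nilScheme F, nilToBase F ⁻¹ᵁ W) ⟶ (nilPresheaf F).obj (op W) :=
  (nilSections F).hom.app (op W)

instance (W : X.Opens) : IsIso (nilSectionsAt F W) :=
  inferInstanceAs (IsIso ((nilSections F).hom.app (op W)))

lemma map_nilSectionsAt {W W' : X.Opens} (h : W' ≤ W)
    (h' : nilToBase F ⁻¹ᵁ W' ≤ nilToBase F ⁻¹ᵁ W) :
    (nilScheme F).presheaf.map (homOfLE h').op ≫ nilSectionsAt F W' =
      nilSectionsAt F W ≫ (nilPresheaf F).map (homOfLE h).op :=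
  (nilSections F).hom.naturality (homOfLE h).op

lemma nilSectionsAt_nilFst (W : X.Opens) :
    nilSectionsAt F W ≫ (nilFst F).app (op W) =
      (nilSection F).appLE _ _ (le_nilSection_preimage F W) :=
  congr_app (nilSections_nilFst F) (op W)

lemma nilToBase_nilSectionsAt (W : X.Opens) :
    (nilToBase F).app W ≫ nilSectionsAt F W = (nilInl F).app (op W) :=
  congr_app (nilToBaseSections_nilSections F) (op W)

lemma nilMap_nilSectionsAt (φ : F ⟶ G) (W : X.Opens) :
    (nilMap φ).appLE _ _ (nilMap_preimage φ W).ge ≫ nilSectionsAt G W =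
      nilSectionsAt F W ≫ (nilPresheafMap φ).app (op W) :=
  congr_app (nilMapSections_nilSections φ) (op W)

/-- The underlying morphism of schemes. -/
def nilHomLeft (f : nilPointed F ⟶ T) : nilScheme F ⟶ T.toScheme := homLeft f

lemma nilSection_nilHomLeft (f : nilPointed F ⟶ T) : nilSection F ≫ nilHomLeft f = T.sec :=
  sec_homLeft f

lemma nilHomLeft_toBase (f : nilPointed F ⟶ T) : nilHomLeft f ≫ T.toBase = nilToBase F :=
  homLeft_toBase f

/-- The map of spaces underlying `f` is `π` followed by the section of `T`. -/
lemma nilToBase_preimage_le (f : nilPointed F ⟶ T) {V : T.toScheme.Opens} {W : X.Opens}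
    (h : W ≤ T.sec ⁻¹ᵁ V) : nilToBase F ⁻¹ᵁ W ≤ nilHomLeft f ⁻¹ᵁ V := by
  rw [← preimage_preimage_of_surjective (nilSection_nilToBase F) (nilSection_surjective F)
    (nilHomLeft f ⁻¹ᵁ V), ← Scheme.Hom.comp_preimage (nilSection F), nilSection_nilHomLeft]
  exact fun _ hx => h hx

/-- The map `Γ(T, V) ⟶ (𝒪_X ⊕ F)(W)` given by a morphism `Nil_X(F) ⟶ T`. -/
def nilHomSections (f : nilPointed F ⟶ T) (V : T.toScheme.Opens) (W : X.Opens)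
    (h : W ≤ T.sec ⁻¹ᵁ V) : Γ(T.toScheme, V) ⟶ (nilPresheaf F).obj (op W) :=
  (nilHomLeft f).appLE V (nilToBase F ⁻¹ᵁ W) (nilToBase_preimage_le f h) ≫ nilSectionsAt F W

/-- The derivation `Γ(T, V) ⟶ Γ(F, W)` given by a morphism `Nil_X(F) ⟶ T`. -/
def nilDer (f : nilPointed F ⟶ T) (V : T.toScheme.Opens) (W : X.Opens)
    (h : W ≤ T.sec ⁻¹ᵁ V) (a : Γ(T.toScheme, V)) : Γ(F, W) :=
  TrivSqZeroExt.snd (R := Γ(X, W)) (nilHomSections f V W h a)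

lemma nilHomSections_fst (f : nilPointed F ⟶ T) (V : T.toScheme.Opens) (W : X.Opens)
    (h : W ≤ T.sec ⁻¹ᵁ V) :
    nilHomSections f V W h ≫ (nilFst F).app (op W) = T.sec.appLE V W h := by
  unfold nilHomSections
  rw [Category.assoc, nilSectionsAt_nilFst, Scheme.Hom.appLE_comp_appLE]
  simp only [nilSection_nilHomLeft]

lemma nilHomSections_apply (f : nilPointed F ⟶ T) (V : T.toScheme.Opens) (W : X.Opens)
    (h : W ≤ T.sec ⁻¹ᵁ V) (a : Γ(T.toScheme, V)) :
    nilHomSections f V W h a =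
      ((T.sec.appLE V W h a, nilDer f V W h a) : TrivSqZeroExt Γ(X, W) Γ(F, W)) :=
  TrivSqZeroExt.ext congr($(nilHomSections_fst f V W h) a) rfl

lemma nilDer_add (f : nilPointed F ⟶ T) (V : T.toScheme.Opens) (W : X.Opens)
    (h : W ≤ T.sec ⁻¹ᵁ V) (a b : Γ(T.toScheme, V)) :
    nilDer f V W h (a + b) = nilDer f V W h a + nilDer f V W h b := by
  unfold nilDer
  rw [map_add]
  rfl

/-- This is the second component of the product in `𝒪_X ⊕ F`; with additivity it makes `nilDer` a
derivation along the section of `T`. -/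
lemma nilDer_mul (f : nilPointed F ⟶ T) (V : T.toScheme.Opens) (W : X.Opens)
    (h : W ≤ T.sec ⁻¹ᵁ V) (a b : Γ(T.toScheme, V)) :
    nilDer f V W h (a * b) =
      T.sec.appLE V W h a • nilDer f V W h b + T.sec.appLE V W h b • nilDer f V W h a := by
  have : nilDer f V W h (a * b) = _ :=
    congr_arg (TrivSqZeroExt.snd (R := Γ(X, W)) (M := Γ(F, W)))
      (map_mul (nilHomSections f V W h).hom a b)
  rw [this]
  erw [nilHomSections_apply, nilHomSections_apply]
  rfl

lemma nilHomSections_map (f : nilPointed F ⟶ T) {V V' : T.toScheme.Opens} {W W' : X.Opens}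
    (h : W ≤ T.sec ⁻¹ᵁ V) (hV : V ≤ V') (hW : W' ≤ W) :
    T.toScheme.presheaf.map (homOfLE hV).op ≫ nilHomSections f V W h ≫
      (nilPresheaf F).map (homOfLE hW).op =
        nilHomSections f V' W' ((hW.trans h).trans fun _ hx => hV hx) := by
  unfold nilHomSections
  rw [Category.assoc, ← map_nilSectionsAt hW (fun _ hx => hW hx), Scheme.Hom.map_appLE_assoc,
    Scheme.Hom.appLE_map_assoc]

lemma nilDer_map (f : nilPointed F ⟶ T) {V V' : T.toScheme.Opens} {W W' : X.Opens}
    (h : W ≤ T.sec ⁻¹ᵁ V) (hV : V ≤ V') (hW : W' ≤ W) (a : Γ(T.toScheme, V')) :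
    F.presheaf.map (homOfLE hW).op (nilDer f V W h (T.toScheme.presheaf.map (homOfLE hV).op a)) =
      nilDer f V' W' ((hW.trans h).trans fun _ hx => hV hx) a :=
  congr_arg (TrivSqZeroExt.snd (R := Γ(X, W')) (M := Γ(F, W')))
    congr($(nilHomSections_map f h hV hW) a)

/-- The first component of `nilHomSections` is restriction along the section of `T`, the same for
`f` and `g`; only the derivation varies. -/
lemma nilHom_ext {f g : nilPointed F ⟶ T}
    (H : ∀ (V : T.toScheme.Opens) (W : X.Opens) (h : W ≤ T.sec ⁻¹ᵁ V) (a : Γ(T.toScheme, V)),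
      nilDer f V W h a = nilDer g V W h a) : f = g := by
  refine PointedOver.hom_ext (hom_ext_of_surjective (nilSection_nilToBase F)
    (nilSection_surjective F) ((sec_homLeft f).trans (sec_homLeft g).symm) fun V W e e' => ?_)
  have h : W ≤ T.sec ⁻¹ᵁ V := by
    rw [← nilSection_nilHomLeft f]
    exact (le_nilSection_preimage F W).trans fun _ hx => e hx
  have : nilHomSections f V W h = nilHomSections g V W h := by
    refine CommRingCat.hom_ext (RingHom.ext fun a => ?_)
    refine (nilHomSections_apply f V W h a).trans (.trans ?_ (nilHomSections_apply g V W h a).symm)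
    rw [H]
  exact (cancel_mono (nilSectionsAt F W)).mp this

lemma nilHomSections_nilPointedMap (φ : F ⟶ G) (f : nilPointed F ⟶ T) (V : T.toScheme.Opens)
    (W : X.Opens) (h : W ≤ T.sec ⁻¹ᵁ V) :
    nilHomSections (nilPointedMap φ ≫ f) V W h =
      nilHomSections f V W h ≫ (nilPresheafMap φ).app (op W) := by
  have h' : nilHomLeft (nilPointedMap φ ≫ f) = nilMap φ ≫ nilHomLeft f := rfl
  unfold nilHomSections
  rw [Category.assoc, ← nilMap_nilSectionsAt, Scheme.Hom.appLE_comp_appLE_assoc]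
  simp only [h']

lemma nilDer_nilPointedMap (φ : F ⟶ G) (f : nilPointed F ⟶ T) (V : T.toScheme.Opens)
    (W : X.Opens) (h : W ≤ T.sec ⁻¹ᵁ V) (a : Γ(T.toScheme, V)) :
    nilDer (nilPointedMap φ ≫ f) V W h a = φ.app W (nilDer f V W h a) :=
  congr_arg (TrivSqZeroExt.snd (R := Γ(X, W)) (M := Γ(G, W)))
    congr($(nilHomSections_nilPointedMap φ f V W h) a)

/-- Since `f` is a morphism over `X`, functions from `X` land in the summand `𝒪_X`. -/
lemma nilDer_toBase (f : nilPointed F ⟶ T) (U : X.Opens) (V : T.toScheme.Opens)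
    (e : V ≤ T.toBase ⁻¹ᵁ U) (W : X.Opens) (h : W ≤ T.sec ⁻¹ᵁ V) (b : Γ(X, U)) :
    nilDer f V W h (T.toBase.appLE U V e b) = 0 := by
  have hWU : W ≤ U := by
    have : T.sec ⁻¹ᵁ T.toBase ⁻¹ᵁ U = U := by
      rw [← Scheme.Hom.comp_preimage, sec_toBase]; rfl
    exact (h.trans fun _ hx => e hx).trans this.le
  have h₁ : T.toBase.appLE U V e ≫ nilHomSections f V W h =
      X.presheaf.map (homOfLE hWU).op ≫ (nilInl F).app (op W) := by
    unfold nilHomSections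
    rw [← nilToBase_nilSectionsAt, Scheme.Hom.appLE_comp_appLE_assoc, Scheme.Hom.app_eq_appLE,
      Scheme.Hom.map_appLE_assoc]
    simp only [nilHomLeft_toBase]
  exact congr_arg (TrivSqZeroExt.snd (R := Γ(X, W)) (M := Γ(F, W))) congr($h₁ b)

/-- The ring homomorphism to a trivial square-zero extension given by a derivation. -/
def derivationRingHom {A R M : Type*} [CommRing A] [CommRing R] [AddCommGroup M] [Module R M]
    [Module Rᵐᵒᵖ M] [IsCentralScalar R M] (s : A →+* R) (d : A → M)
    (hadd : ∀ a b, d (a + b) = d a + d b) (hmul : ∀ a b, d (a * b) = s a • d b + s b • d a) :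
    A →+* TrivSqZeroExt R M :=
  have h0 : d 0 = 0 := by simpa using hadd 0 0
  have h1 : d 1 = 0 := by simpa using hmul 1 1
  { toFun a := (s a, d a)
    map_one' := TrivSqZeroExt.ext (map_one s) h1
    map_mul' a b := TrivSqZeroExt.ext (map_mul s a b) ((hmul a b).trans
      (congr_arg _ (op_smul_eq_smul (s b) (d a)).symm))
    map_zero' := TrivSqZeroExt.ext (map_zero s) h0
    map_add' a b := TrivSqZeroExt.ext (map_add s a b) (hadd a b) }

/-- The converse of `nilHom_ext`: every `X`-derivation along the section comes from a morphism. It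
is enough to give it on the pairs `(V, T.sec ⁻¹ᵁ V)`, the remaining values being restrictions. -/
lemma exists_nilHom (d : ∀ V : T.toScheme.Opens, Γ(T.toScheme, V) → Γ(F, T.sec ⁻¹ᵁ V))
    (hadd : ∀ V a b, d V (a + b) = d V a + d V b)
    (hmul : ∀ V a b, d V (a * b) = T.sec.app V a • d V b + T.sec.app V b • d V a)
    (hmap : ∀ (V W : T.toScheme.Opens) (h : W ≤ V) (h' : T.sec ⁻¹ᵁ W ≤ T.sec ⁻¹ᵁ V) a,
      F.presheaf.map (homOfLE h').op (d V a) = d W (T.toScheme.presheaf.map (homOfLE h).op a))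
    (hbase : ∀ (U : X.Opens) b, d (T.toBase ⁻¹ᵁ U) (T.toBase.app U b) = 0) :
    ∃ f : nilPointed F ⟶ T, ∀ (V : T.toScheme.Opens) (W : X.Opens) (h : W ≤ T.sec ⁻¹ᵁ V)
      (a : Γ(T.toScheme, V)), nilDer f V W h a = F.presheaf.map (homOfLE h).op (d V a) := by
  let θ (V : T.toScheme.Opens) : Γ(T.toScheme, V) ⟶ (nilPresheaf F).obj (op (T.sec ⁻¹ᵁ V)) :=
    CommRingCat.ofHom (derivationRingHom (T.sec.app V).hom (d V) (hadd V) (hmul V))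
  obtain ⟨f, hf, hf'⟩ := exists_hom_of_surjective (nilSection_nilToBase F)
    (nilSection_surjective F) T.sec (fun V => θ V ≫ inv (nilSectionsAt F (T.sec ⁻¹ᵁ V))) (by
      intro V W h
      have hW : T.sec ⁻¹ᵁ W ≤ T.sec ⁻¹ᵁ V := fun _ hx => h hx
      have h₁ : θ V ≫ (nilPresheaf F).map (homOfLE hW).op =
          T.toScheme.presheaf.map (homOfLE h).op ≫ θ W :=
        nilRing_hom_ext (fun a => congr($(T.sec.naturality (homOfLE h).op) a).symm)
          (fun a => hmap V W h _ a)
      rw [← cancel_mono (nilSectionsAt F (T.sec ⁻¹ᵁ W)), Category.assoc, Category.assoc,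
        map_nilSectionsAt hW, IsIso.inv_hom_id_assoc, h₁, Category.assoc,
        Category.assoc, IsIso.inv_hom_id, Category.comp_id]) (by
      intro V e
      rw [Category.assoc, ← nilSectionsAt_nilFst, IsIso.inv_hom_id_assoc]
      rfl)
  have hθ (V : T.toScheme.Opens) (e : nilToBase F ⁻¹ᵁ T.sec ⁻¹ᵁ V ≤ f ⁻¹ᵁ V) :
      f.appLE V _ e ≫ nilSectionsAt F (T.sec ⁻¹ᵁ V) = θ V := by
    rw [hf' V e, Category.assoc, IsIso.inv_hom_id, Category.comp_id]
  -- Along `σ` both sides are the identity of `X`; on functions they agree because `d` vanishes on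
  -- functions from `X`.
  have hb : f ≫ T.toBase = nilToBase F := by
    refine hom_ext_of_surjective (nilSection_nilToBase F) (nilSection_surjective F) ?_ ?_
    · rw [← Category.assoc, hf, sec_toBase, nilSection_nilToBase]
    · intro V U e e'
      have h₀ : T.sec ⁻¹ᵁ T.toBase ⁻¹ᵁ V = V := by
        rw [← Scheme.Hom.comp_preimage, sec_toBase]; rfl
      have h₁ : nilToBase F ⁻¹ᵁ T.sec ⁻¹ᵁ T.toBase ⁻¹ᵁ V ≤ f ⁻¹ᵁ T.toBase ⁻¹ᵁ V := by
        rw [← preimage_preimage_of_surjective (nilSection_nilToBase F) (nilSection_surjective F)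
          (f ⁻¹ᵁ T.toBase ⁻¹ᵁ V), ← Scheme.Hom.comp_preimage (nilSection F), hf]
      have hUV : U ≤ V := by
        have : nilSection F ⁻¹ᵁ nilToBase F ⁻¹ᵁ V = V := by
          rw [← Scheme.Hom.comp_preimage, nilSection_nilToBase]; rfl
        exact ((le_nilSection_preimage F U).trans fun _ hx => e' hx).trans this.le
      have h₂ : U ≤ T.sec ⁻¹ᵁ T.toBase ⁻¹ᵁ V := hUV.trans h₀.ge
      have h₃ : T.toBase.app V ≫ θ (T.toBase ⁻¹ᵁ V) =
          X.presheaf.map (homOfLE h₀.le).op ≫ (nilInl F).app (op _) := by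
        refine nilRing_hom_ext (fun a => ?_) (fun a => hbase V a)
        have : T.toBase.app V ≫ T.sec.app (T.toBase ⁻¹ᵁ V) = X.presheaf.map (homOfLE h₀.le).op := by
          rw [← Scheme.Hom.comp_app, Scheme.Hom.app_eq_appLE]
          simp only [sec_toBase]
          exact Category.id_comp _
        exact congr($this a)
      have h₄ : nilToBase F ⁻¹ᵁ U ≤ nilToBase F ⁻¹ᵁ T.sec ⁻¹ᵁ T.toBase ⁻¹ᵁ V :=
        fun _ hx => h₂ hx
      have h₅ : (f ≫ T.toBase).appLE V (nilToBase F ⁻¹ᵁ U) e ≫ nilSectionsAt F U =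
          T.toBase.app V ≫ θ (T.toBase ⁻¹ᵁ V) ≫ (nilPresheaf F).map (homOfLE h₂).op := by
        rw [← hθ _ h₁, Category.assoc, ← map_nilSectionsAt h₂ h₄, Scheme.Hom.appLE_map_assoc,
          Scheme.Hom.comp_appLE, Category.assoc]
      have h₆ : (nilToBase F).appLE V (nilToBase F ⁻¹ᵁ U) e' ≫ nilSectionsAt F U =
          (nilInl F).app (op V) ≫ (nilPresheaf F).map (homOfLE hUV).op := by
        rw [← nilToBase_nilSectionsAt, Category.assoc, ← map_nilSectionsAt hUV e',
          Scheme.Hom.app_eq_appLE, Scheme.Hom.appLE_map_assoc]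
      rw [← cancel_mono (nilSectionsAt F U), h₅, h₆, reassoc_of% h₃, ← NatTrans.naturality,
        ← NatTrans.naturality, ← Functor.map_comp_assoc]
      rfl
  let f' : nilPointed F ⟶ T := homOf f hb hf
  refine ⟨f', fun V W h a => ?_⟩
  have h₁ : nilHomSections f' V (T.sec ⁻¹ᵁ V) le_rfl = θ V := hθ V _
  have h₂ : nilDer f' V (T.sec ⁻¹ᵁ V) le_rfl a = d V a :=
    congr_arg (TrivSqZeroExt.snd (R := Γ(X, T.sec ⁻¹ᵁ V)) (M := Γ(F, T.sec ⁻¹ᵁ V))) congr($h₁ a)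
  rw [← nilDer_map f' (V := V) le_rfl le_rfl h]
  have h₃ : T.toScheme.presheaf.map (homOfLE (le_refl V)).op = 𝟙 _ := T.toScheme.presheaf.map_id _
  rw [h₃, ← h₂]
  rfl

end Derivation

/-! ### The coproduct `Nil_X(F) ⨿ Nil_X(F)` -/

section Coproduct

variable {X : Scheme.{u}} (F : X.Modules) [F.IsQuasicoherent] {T : PointedOver X}

lemma modules_app_map {F G : X.Modules} (φ : F ⟶ G) {U V : X.Opens} (h : V ≤ U) (t : Γ(F, U)) :
    φ.app V (F.presheaf.map (homOfLE h).op t) = G.presheaf.map (homOfLE h).op (φ.app U t) :=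
  congr($(φ.mapPresheaf.naturality (homOfLE h).op) t)

lemma modules_comp_app_apply {F G H : X.Modules} (φ : F ⟶ G) (ψ : G ⟶ H) {U : X.Opens}
    (t : Γ(F, U)) : ψ.app U (φ.app U t) = (φ ≫ ψ).app U t := rfl

lemma modules_biprod_ext {F G : X.Modules} {U : X.Opens} {s t : Γ(F ⊞ G, U)}
    (h₁ : (biprod.fst : F ⊞ G ⟶ F).app U s = (biprod.fst : F ⊞ G ⟶ F).app U t)
    (h₂ : (biprod.snd : F ⊞ G ⟶ G).app U s = (biprod.snd : F ⊞ G ⟶ G).app U t) : s = t := by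
  have h (x : Γ(F ⊞ G, U)) : x = (biprod.inl : F ⟶ F ⊞ G).app U
      ((biprod.fst : F ⊞ G ⟶ F).app U x) +
        (biprod.inr : G ⟶ F ⊞ G).app U ((biprod.snd : F ⊞ G ⟶ G).app U x) := by
    have := congr(Scheme.Modules.Hom.app $(biprod.total (X := F) (Y := G)) U x)
    exact this.symm
  rw [h s, h t, h₁, h₂]

instance isQuasicoherent_biprod_instance : (F ⊞ F).IsQuasicoherent := isQuasicoherent_biprod F F

variable {F} in
-- If `d` and `d'` are the derivations of `f` and `g`, then `inl ∘ d + inr ∘ d'` is a derivation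
-- into `F ⊕ F` with these components.
lemma exists_nilHom_biprod (f g : nilPointed F ⟶ T) :
    ∃ k : nilPointed (F ⊞ F) ⟶ T, nilPointedMap biprod.fst ≫ k = f ∧
      nilPointedMap biprod.snd ≫ k = g := by
  obtain ⟨k, hk⟩ := exists_nilHom (F := F ⊞ F) (T := T)
    (fun V a => (biprod.inl : F ⟶ F ⊞ F).app _ (nilDer f V _ le_rfl a) +
      (biprod.inr : F ⟶ F ⊞ F).app _ (nilDer g V _ le_rfl a))
    (fun V a b => by
      rw [nilDer_add, nilDer_add, map_add, map_add]
      abel)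
    (fun V a b => by
      rw [nilDer_mul, nilDer_mul, map_add, map_add]
      simp only [Scheme.Modules.Hom.app_smul, smul_add, Scheme.Hom.app_eq_appLE]
      abel)
    (fun V W h h' a => by
      have h₁ (f : nilPointed F ⟶ T) : F.presheaf.map (homOfLE h').op (nilDer f V _ le_rfl a) =
          nilDer f W _ le_rfl (T.toScheme.presheaf.map (homOfLE h).op a) := by
        have h₂ := nilDer_map f (V := V) le_rfl le_rfl h' a
        have h₃ := nilDer_map f (V := W) le_rfl h le_rfl a
        rw [modules_map_self] at h₃
        have e : T.toScheme.presheaf.map (homOfLE (le_refl V)).op = 𝟙 _ :=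
          T.toScheme.presheaf.map_id _
        rw [e] at h₂
        exact h₂.trans h₃.symm
      rw [map_add, ← modules_app_map, ← modules_app_map, h₁, h₁])
    (fun U b => by
      rw [Scheme.Hom.app_eq_appLE, nilDer_toBase, nilDer_toBase, map_zero, map_zero, add_zero])
  refine ⟨k, nilHom_ext fun V W h a => ?_, nilHom_ext fun V W h a => ?_⟩
  all_goals
    rw [nilDer_nilPointedMap, hk, modules_app_map, map_add]
    simp only [modules_comp_app_apply, biprod.inl_fst, biprod.inr_fst, biprod.inl_snd,
      biprod.inr_snd]
    have e : T.toScheme.presheaf.map (homOfLE (le_refl V)).op = 𝟙 _ :=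
      T.toScheme.presheaf.map_id _
  · have := nilDer_map f (V := V) le_rfl le_rfl h a
    rw [e] at this
    refine .trans ?_ this
    simp
  · have := nilDer_map g (V := V) le_rfl le_rfl h a
    rw [e] at this
    refine .trans ?_ this
    simp

variable {F} in
lemma nilHom_biprod_ext {k l : nilPointed (F ⊞ F) ⟶ T}
    (h₁ : nilPointedMap (biprod.fst : F ⊞ F ⟶ F) ≫ k = nilPointedMap biprod.fst ≫ l)
    (h₂ : nilPointedMap (biprod.snd : F ⊞ F ⟶ F) ≫ k = nilPointedMap biprod.snd ≫ l) : k = l := by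
  refine nilHom_ext fun V W h a => modules_biprod_ext ?_ ?_
  · rw [← nilDer_nilPointedMap, ← nilDer_nilPointedMap, h₁]
  · rw [← nilDer_nilPointedMap, ← nilDer_nilPointedMap, h₂]

/-- `Nil_X(F ⊕ F)` is the coproduct of two copies of `Nil_X(F)`. -/
def isColimitNilBiprod : IsColimit (BinaryCofan.mk (nilPointedMap (biprod.fst : F ⊞ F ⟶ F))
    (nilPointedMap (biprod.snd : F ⊞ F ⟶ F))) :=
  BinaryCofan.IsColimit.mk _ (fun f g => (exists_nilHom_biprod f g).choose)
    (fun f g => (exists_nilHom_biprod f g).choose_spec.1)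
    (fun f g => (exists_nilHom_biprod f g).choose_spec.2)
    (fun f g _ h₁ h₂ => nilHom_biprod_ext
      (h₁.trans (exists_nilHom_biprod f g).choose_spec.1.symm)
      (h₂.trans (exists_nilHom_biprod f g).choose_spec.2.symm))

instance hasBinaryCoproduct_nilPointed : HasBinaryCoproduct (nilPointed F) (nilPointed F) :=
  ⟨⟨_, isColimitNilBiprod F⟩⟩

/-- The canonical map `Nil_X(F) ⨿ Nil_X(F) ⟶ Nil_X(F ⊕ F)`. -/
def nilCoprodDesc : nilPointed F ⨿ nilPointed F ⟶ nilPointed (F ⊞ F) :=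
  coprod.desc (nilPointedMap biprod.fst) (nilPointedMap biprod.snd)

instance : IsIso (nilCoprodDesc F) := by
  have : nilCoprodDesc F = ((coprodIsCoprod (nilPointed F) (nilPointed F)).coconePointUniqueUpToIso
      (isColimitNilBiprod F)).hom := by
    apply coprod.hom_ext
    · rw [nilCoprodDesc, coprod.inl_desc]
      exact ((coprodIsCoprod _ _).comp_coconePointUniqueUpToIso_hom (isColimitNilBiprod F)
        ⟨.left⟩).symm
    · rw [nilCoprodDesc, coprod.inr_desc]
      exact ((coprodIsCoprod _ _).comp_coconePointUniqueUpToIso_hom (isColimitNilBiprod F)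
        ⟨.right⟩).symm
  rw [this]
  exact Iso.isIso_hom _

/-- The comultiplication of `Nil_X(F)`. -/
def nilComul : nilPointed F ⟶ nilPointed F ⨿ nilPointed F :=
  nilPointedMap (biprod.desc (𝟙 F) (𝟙 F)) ≫ inv (nilCoprodDesc F)

variable {F} in
-- The operation induced by the comultiplication on morphisms to `T` is addition of derivations,
-- because the addition `F ⊕ F ⟶ F` is the sum of the two projections. All cogroup axioms follow
-- from this formula.
lemma nilDer_nilComul (k : nilPointed F ⨿ nilPointed F ⟶ T) (V : T.toScheme.Opens) (W : X.Opens)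
    (h : W ≤ T.sec ⁻¹ᵁ V) (a : Γ(T.toScheme, V)) :
    nilDer (nilComul F ≫ k) V W h a =
      nilDer (coprod.inl ≫ k) V W h a + nilDer (coprod.inr ≫ k) V W h a := by
  obtain ⟨l, rfl⟩ : ∃ l, k = nilCoprodDesc F ≫ l := ⟨inv (nilCoprodDesc F) ≫ k, by simp⟩
  have h₁ : coprod.inl ≫ nilCoprodDesc F ≫ l = nilPointedMap biprod.fst ≫ l := by
    rw [← Category.assoc, nilCoprodDesc, coprod.inl_desc]
  have h₂ : coprod.inr ≫ nilCoprodDesc F ≫ l = nilPointedMap biprod.snd ≫ l := by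
    rw [← Category.assoc, nilCoprodDesc, coprod.inr_desc]
  have h₃ : biprod.desc (𝟙 F) (𝟙 F) = biprod.fst + biprod.snd := by
    apply biprod.hom_ext' <;> simp
  rw [h₁, h₂, nilComul, Category.assoc, IsIso.inv_hom_id_assoc, nilDer_nilPointedMap,
    nilDer_nilPointedMap, nilDer_nilPointedMap, h₃]
  rfl

variable (X) in
/-- The zero object `X` of `X/Sch_X`. -/
def pointedZero : PointedOver X := Under.mk (𝟙 (Over.mk (𝟙 X)))

variable (X) in
/-- `X` is terminal in `X/Sch_X`. -/
lemma pointedZero_hom_subsingleton {Y : PointedOver X} (f g : Y ⟶ pointedZero X) : f = g := by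
  refine PointedOver.hom_ext ?_
  have hf := homLeft_toBase f
  have hg := homLeft_toBase g
  exact (Category.comp_id _).symm.trans ((hf.trans hg.symm).trans (Category.comp_id _))

/-- The map from `Y` to the initial object of `X/Sch_X`. -/
def pointedCounit (Y : PointedOver X) : Y ⟶ ⊥_ (PointedOver X) :=
  homOf (T' := pointedZero X) Y.toBase (Category.comp_id _) Y.sec_toBase ≫
    (initialIsoIsInitial (Under.mkIdInitial (X := Over.mk (𝟙 X)))).inv

/-- The initial object is `X` with its identity, which is also terminal. -/
lemma pointedCounit_unique {Y : PointedOver X} (f g : Y ⟶ ⊥_ (PointedOver X)) : f = g := by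
  rw [← cancel_mono (initialIsoIsInitial (Under.mkIdInitial (X := Over.mk (𝟙 X)))).hom]
  exact pointedZero_hom_subsingleton X _ _

variable {F} in
-- Maps to the zero object are unique, so composing with `Nil_X(0)` in front changes nothing; but it
-- multiplies the derivation by `0`.
lemma nilDer_counit (p : nilPointed F ⟶ ⊥_ (PointedOver X)) (V : T.toScheme.Opens) (W : X.Opens)
    (h : W ≤ T.sec ⁻¹ᵁ V) (a : Γ(T.toScheme, V)) :
    nilDer (p ≫ initial.to T) V W h a = 0 := by
  have : p ≫ initial.to T = nilPointedMap (0 : F ⟶ F) ≫ p ≫ initial.to T := by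
    rw [← Category.assoc]
    congr 1
    exact pointedCounit_unique _ _
  rw [this, nilDer_nilPointedMap]
  rfl

instance nilAbCogroupObj : AbCogroupObj (nilPointed F) where
  comul := nilComul F
  counit := pointedCounit _
  antipode := nilPointedMap (-𝟙 F)
  coassoc f g h := nilHom_ext fun V W e a => by
    simp only [nilDer_nilComul, coprod.inl_desc, coprod.inr_desc, add_assoc]
  counit_left := nilHom_ext fun V W e a => by
    simp only [nilDer_nilComul, coprod.inl_desc, coprod.inr_desc, nilDer_counit, zero_add]
  counit_right := nilHom_ext fun V W e a => by
    simp only [nilDer_nilComul, coprod.inl_desc, coprod.inr_desc, nilDer_counit, add_zero]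
  antipode_left := nilHom_ext fun V W e a => by
    -- The trailing identity puts the antipode in the form to which `nilDer_nilPointedMap` applies.
    rw [← Category.comp_id (nilPointedMap (-𝟙 F))]
    simp only [nilDer_nilComul, coprod.inl_desc, coprod.inr_desc, nilDer_counit,
      nilDer_nilPointedMap]
    exact neg_add_cancel _
  antipode_right := nilHom_ext fun V W e a => by
    rw [← Category.comp_id (nilPointedMap (-𝟙 F))]
    simp only [nilDer_nilComul, coprod.inl_desc, coprod.inr_desc, nilDer_counit,
      nilDer_nilPointedMap]
    exact add_neg_cancel _
  cocomm := nilHom_ext fun V W e a => by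
    have := nilDer_nilComul (𝟙 (nilPointed F ⨿ nilPointed F)) V W e a
    rw [Category.comp_id, Category.comp_id, Category.comp_id] at this
    rw [nilDer_nilComul, coprod.inl_desc, coprod.inr_desc, this, add_comm]

variable {F} in
-- On derivations this is the additivity of `φ`.
lemma nilComul_naturality {G : X.Modules} [G.IsQuasicoherent] (φ : F ⟶ G) :
    nilComul G ≫ coprod.map (nilPointedMap φ) (nilPointedMap φ) =
      nilPointedMap φ ≫ nilComul F := nilHom_ext fun V W e a => by
  rw [nilDer_nilComul, coprod.inl_map, coprod.inr_map, nilDer_nilPointedMap, nilDer_nilPointedMap,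
    nilDer_nilPointedMap, ← map_add]
  conv_rhs => rw [← Category.comp_id (nilComul F)]
  rw [nilDer_nilComul, Category.comp_id, Category.comp_id]

end Coproduct

/-! ### Full faithfulness -/

section FullyFaithful

variable {X : Scheme.{u}} 

/-- A morphism of modules from a compatible family of linear maps. -/
def modulesHomMk {F G : X.Modules} (f : ∀ U : X.Opens, Γ(F, U) → Γ(G, U))
    (hadd : ∀ U s t, f U (s + t) = f U s + f U t)
    (hsmul : ∀ U (r : Γ(X, U)) s, f U (r • s) = r • f U s)
    (hmap : ∀ (U V : X.Opens) (h : V ≤ U) s,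
      f V (F.presheaf.map (homOfLE h).op s) = G.presheaf.map (homOfLE h).op (f U s)) : F ⟶ G :=
  SheafOfModules.Hom.mk (PresheafOfModules.homMk
    { app U := AddCommGrpCat.ofHom (AddMonoidHom.mk' (f U.unop) (hadd U.unop))
      naturality U V i := by
        ext s
        exact hmap U.unop V.unop i.unop.le s } fun U r s => hsmul U.unop r s)

lemma modulesHomMk_app {F G : X.Modules} (f : ∀ U : X.Opens, Γ(F, U) → Γ(G, U))
    (hadd : ∀ U s t, f U (s + t) = f U s + f U t)
    (hsmul : ∀ U (r : Γ(X, U)) s, f U (r • s) = r • f U s)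
    (hmap : ∀ (U V : X.Opens) (h : V ≤ U) s,
      f V (F.presheaf.map (homOfLE h).op s) = G.presheaf.map (homOfLE h).op (f U s))
    (U : X.Opens) (s : Γ(F, U)) : (modulesHomMk f hadd hsmul hmap).app U s = f U s := rfl

variable {F G : X.Modules} [F.IsQuasicoherent] [G.IsQuasicoherent]

/-- The section of `Nil_X(F)` given by a section of `F`. -/
def nilInr (W : X.Opens) (m : Γ(F, W)) : Γ(nilScheme F, nilToBase F ⁻¹ᵁ W) :=
  inv (nilSectionsAt F W) ((0, m) : TrivSqZeroExt Γ(X, W) Γ(F, W))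

lemma nilSectionsAt_nilInr (W : X.Opens) (m : Γ(F, W)) :
    nilSectionsAt F W (nilInr W m) = ((0, m) : TrivSqZeroExt Γ(X, W) Γ(F, W)) :=
  congr($(IsIso.inv_hom_id (nilSectionsAt F W)) ((0, m) : TrivSqZeroExt Γ(X, W) Γ(F, W)))

lemma nilSectionsAt_nilToBase (W : X.Opens) (r : Γ(X, W)) :
    nilSectionsAt F W ((nilToBase F).app W r) = ((r, 0) : TrivSqZeroExt Γ(X, W) Γ(F, W)) :=
  congr($(nilToBase_nilSectionsAt (F := F) W) r)

lemma nilSectionsAt_injective (W : X.Opens) : Function.Injective (nilSectionsAt F W) := 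
  (ConcreteCategory.bijective_of_isIso (nilSectionsAt F W)).1

lemma nilInr_add (W : X.Opens) (m n : Γ(F, W)) : nilInr W (m + n) = nilInr W m + nilInr W n := by
  apply nilSectionsAt_injective
  rw [map_add, nilSectionsAt_nilInr]
  erw [nilSectionsAt_nilInr, nilSectionsAt_nilInr]
  exact TrivSqZeroExt.ext (add_zero _).symm rfl

lemma nilInr_smul (W : X.Opens) (r : Γ(X, W)) (m : Γ(F, W)) :
    nilInr W (r • m) = (nilToBase F).app W r * nilInr W m := by
  apply nilSectionsAt_injective
  rw [map_mul, nilSectionsAt_nilInr]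
  erw [nilSectionsAt_nilInr, nilSectionsAt_nilToBase]
  refine TrivSqZeroExt.ext (mul_zero r).symm ?_
  change _ = r • m + MulOpposite.op (0 : Γ(X, W)) • (0 : Γ(F, W))
  rw [smul_zero, add_zero]
  rfl

lemma nilInr_map {W W' : X.Opens} (h : W' ≤ W) (h' : nilToBase F ⁻¹ᵁ W' ≤ nilToBase F ⁻¹ᵁ W)
    (m : Γ(F, W)) : nilInr W' (F.presheaf.map (homOfLE h).op m) =
      (nilScheme F).presheaf.map (homOfLE h').op (nilInr W m) := by
  apply nilSectionsAt_injective
  refine (nilSectionsAt_nilInr _ _).trans ?_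
  refine .trans ?_ congr($(map_nilSectionsAt h h') (nilInr W m)).symm
  refine .trans ?_ (congr_arg ((nilPresheaf F).map (homOfLE h).op) (nilSectionsAt_nilInr W m)).symm
  exact TrivSqZeroExt.ext (map_zero _).symm rfl

lemma nilSection_nilToBase_appLE (W : X.Opens) (r : Γ(X, W))
    (h : W ≤ nilSection F ⁻¹ᵁ nilToBase F ⁻¹ᵁ W) :
    (nilSection F).appLE _ _ h ((nilToBase F).app W r) = r := by
  refine congr($(nilSectionsAt_nilFst (F := F) W) _).symm.trans ?_
  exact congr_arg ((nilFst F).app (op W)) (nilSectionsAt_nilToBase W r)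

lemma eq_nilToBase_add_nilInr (W : X.Opens) (a : Γ(nilScheme F, nilToBase F ⁻¹ᵁ W)) :
    ∃ r m, a = (nilToBase F).app W r + nilInr W m := by
  let b : TrivSqZeroExt Γ(X, W) Γ(F, W) := nilSectionsAt F W a
  refine ⟨b.fst, b.snd, nilSectionsAt_injective W ?_⟩
  rw [map_add]
  erw [nilSectionsAt_nilInr, nilSectionsAt_nilToBase]
  exact TrivSqZeroExt.ext (add_zero _).symm (zero_add _).symm

/-- The map `Γ(Nil_X(F), π⁻¹ W) ⟶ Γ(G, W)` given by a morphism `Nil_X(G) ⟶ Nil_X(F)`. -/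
def nilCoeff (f : nilPointed G ⟶ nilPointed F) (W : X.Opens)
    (a : Γ(nilScheme F, nilToBase F ⁻¹ᵁ W)) : Γ(G, W) :=
  nilDer f (nilToBase F ⁻¹ᵁ W) W (le_nilSection_preimage F W) a

lemma nilCoeff_add (f : nilPointed G ⟶ nilPointed F) (W : X.Opens)
    (a b : Γ(nilScheme F, nilToBase F ⁻¹ᵁ W)) :
    nilCoeff f W (a + b) = nilCoeff f W a + nilCoeff f W b :=
  nilDer_add f _ _ _ a b

lemma nilCoeff_nilToBase (f : nilPointed G ⟶ nilPointed F) (W : X.Opens) (r : Γ(X, W)) :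
    nilCoeff f W ((nilToBase F).app W r) = 0 := by
  rw [Scheme.Hom.app_eq_appLE]
  exact nilDer_toBase f W _ le_rfl W _ r

/-- In the Leibniz rule the term with the derivative of `r` drops out, since `r` comes from `X`, and
`σ^* π^* r = r`. -/
lemma nilCoeff_smul (f : nilPointed G ⟶ nilPointed F) (W : X.Opens) (r : Γ(X, W))
    (m : Γ(F, W)) : nilCoeff f W (nilInr W (r • m)) = r • nilCoeff f W (nilInr W m) := by
  have h : nilCoeff f W ((nilToBase F).app W r * nilInr W m) =
      (nilSection F).appLE _ _ (le_nilSection_preimage F W) ((nilToBase F).app W r) •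
        nilCoeff f W (nilInr W m) +
      (nilSection F).appLE _ _ (le_nilSection_preimage F W) (nilInr W m) •
        nilCoeff f W ((nilToBase F).app W r) := nilDer_mul f _ _ _ _ _
  rw [nilInr_smul, h, nilCoeff_nilToBase, nilSection_nilToBase_appLE, smul_zero, add_zero]

lemma nilCoeff_map (f : nilPointed G ⟶ nilPointed F) {W W' : X.Opens} (h : W' ≤ W)
    (h' : nilToBase F ⁻¹ᵁ W' ≤ nilToBase F ⁻¹ᵁ W) (a : Γ(nilScheme F, nilToBase F ⁻¹ᵁ W)) :
    nilCoeff f W' ((nilScheme F).presheaf.map (homOfLE h').op a) =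
      G.presheaf.map (homOfLE h).op (nilCoeff f W a) := by
  have h₁ := nilDer_map f (le_nilSection_preimage F W') h' (le_refl W') a
  have h₂ := nilDer_map f (le_nilSection_preimage F W) le_rfl h a
  rw [modules_map_self] at h₁
  have e : (nilScheme F).presheaf.map (homOfLE (le_refl (nilToBase F ⁻¹ᵁ W))).op = 𝟙 _ :=
    (nilScheme F).presheaf.map_id _
  erw [e] at h₂
  exact h₁.trans h₂.symm

lemma nilCoeff_id (W : X.Opens) (m : Γ(F, W)) :
    nilCoeff (𝟙 (nilPointed F)) W (nilInr W m) = m := by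
  have h : nilHomSections (𝟙 (nilPointed F)) (nilToBase F ⁻¹ᵁ W) W (le_nilSection_preimage F W) =
      nilSectionsAt F W := by
    have h₁ : nilHomLeft (𝟙 (nilPointed F)) = 𝟙 _ := rfl
    have h₂ (e) : (𝟙 (nilScheme F) : nilScheme F ⟶ nilScheme F).appLE (nilToBase F ⁻¹ᵁ W)
        (nilToBase F ⁻¹ᵁ W) e = 𝟙 _ := (Scheme.Hom.appLE_eq_app _).trans (Scheme.Hom.id_app _)
    unfold nilHomSections
    simp only [h₁]
    exact (congr_arg (· ≫ nilSectionsAt F W) (h₂ _)).trans (Category.id_comp _)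
  exact (congr_arg (TrivSqZeroExt.snd (R := Γ(X, W)) (M := Γ(F, W))) congr($h (nilInr W m))).trans
    (congr_arg (TrivSqZeroExt.snd (R := Γ(X, W)) (M := Γ(F, W))) (nilSectionsAt_nilInr W m))

/-- Functions on `Nil_X(F)` split as `π^* r` plus a section of `F`, and the derivation kills `π^*
r`. -/
lemma nilPointed_hom_ext {f g : nilPointed G ⟶ nilPointed F}
    (H : ∀ (W : X.Opens) (m : Γ(F, W)), nilCoeff f W (nilInr W m) = nilCoeff g W (nilInr W m)) :
    f = g := by
  refine nilHom_ext fun V W h a => ?_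
  have hV : nilToBase F ⁻¹ᵁ W ≤ V := by
    rw [← preimage_preimage_of_surjective (nilSection_nilToBase F) (nilSection_surjective F) V]
    exact fun _ hx => h hx
  have h₁ (f : nilPointed G ⟶ nilPointed F) :
      nilCoeff f W ((nilScheme F).presheaf.map (homOfLE hV).op a) = nilDer f V W h a := by
    have := nilDer_map f (le_nilSection_preimage F W) hV (le_refl W) a
    rwa [modules_map_self] at this
  rw [← h₁, ← h₁]
  obtain ⟨r, m, hr⟩ := eq_nilToBase_add_nilInr W ((nilScheme F).presheaf.map (homOfLE hV).op a)
  rw [hr, nilCoeff_add, nilCoeff_add, nilCoeff_nilToBase, nilCoeff_nilToBase, H]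

lemma nilCoeff_nilPointedMap (φ : F ⟶ G) (W : X.Opens) (m : Γ(F, W)) :
    nilCoeff (nilPointedMap φ) W (nilInr W m) = φ.app W m := by
  refine .trans ?_ (congr_arg _ (nilCoeff_id W m))
  exact .trans (by rw [Category.comp_id]; rfl) (nilDer_nilPointedMap φ (𝟙 (nilPointed F)) _ W _ _)

lemma nilPointedMap_injective {φ ψ : F ⟶ G} (h : nilPointedMap φ = nilPointedMap ψ) : φ = ψ := by
  refine Scheme.Modules.hom_ext _ _ fun W => ?_
  ext m
  rw [← nilCoeff_nilPointedMap, h, nilCoeff_nilPointedMap]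

/-- The derivation attached to `f` is `𝒪_X`-linear on the summand `F`; this restriction is the
required `φ`. -/
lemma nilPointedMap_surjective (f : nilPointed G ⟶ nilPointed F) :
    ∃ φ : F ⟶ G, nilPointedMap φ = f := by
  refine ⟨modulesHomMk (fun W m => nilCoeff f W (nilInr W m))
    (fun W m n => by rw [nilInr_add, nilCoeff_add]) (fun W r m => nilCoeff_smul f W r m)
    (fun U V h m => ?_), nilPointed_hom_ext fun W m => ?_⟩
  · have h' : nilToBase F ⁻¹ᵁ V ≤ nilToBase F ⁻¹ᵁ U := fun _ hx => h hx
    rw [nilInr_map h h', nilCoeff_map f h h']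
  · rw [nilCoeff_nilPointedMap, modulesHomMk_app]

end FullyFaithful

/-! ### Uniqueness of the comultiplication -/

section Uniqueness

variable {X : Scheme.{u}} {F : X.Modules} [F.IsQuasicoherent]

lemma nilPointedMap_zero {G : X.Modules} [G.IsQuasicoherent]
    (p : nilPointed G ⟶ ⊥_ (PointedOver X)) :
    nilPointedMap (0 : F ⟶ G) = p ≫ initial.to (nilPointed F) := nilHom_ext fun V W h a => by
  rw [nilDer_counit, ← Category.comp_id (nilPointedMap (0 : F ⟶ G)), nilDer_nilPointedMap]
  rfl

lemma nilPointedMap_comp {G H : X.Modules} [G.IsQuasicoherent] [H.IsQuasicoherent] (φ : F ⟶ G)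
    (ψ : G ⟶ H) : nilPointedMap (φ ≫ ψ) = nilPointedMap ψ ≫ nilPointedMap φ :=
  PointedOver.hom_ext (nilMap_comp φ ψ)

lemma nilPointedMap_id : nilPointedMap (𝟙 F) = 𝟙 (nilPointed F) :=
  PointedOver.hom_ext (nilMap_id F)

/-- By full faithfulness `c` corresponds to some `ψ : F ⊕ F ⟶ F`. The two counit axioms say that `ψ`
is the identity on each summand, so `ψ` is the addition. -/
lemma eq_nilComul (c : nilPointed F ⟶ nilPointed F ⨿ nilPointed F)
    (p : nilPointed F ⟶ ⊥_ (PointedOver X))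
    (h₁ : c ≫ coprod.desc (p ≫ initial.to _) (𝟙 _) = 𝟙 _)
    (h₂ : c ≫ coprod.desc (𝟙 _) (p ≫ initial.to _) = 𝟙 _) : c = nilComul F := by
  obtain ⟨ψ, hψ⟩ := nilPointedMap_surjective (c ≫ nilCoprodDesc F)
  -- Under the comparison isomorphism, the maps of the counit axioms are `Nil_X` of the two
  -- inclusions `F ⟶ F ⊕ F`.
  have hl : nilCoprodDesc F ≫ nilPointedMap biprod.inl =
      coprod.desc (𝟙 _) (p ≫ initial.to _) := by
    apply coprod.hom_ext
    · rw [nilCoprodDesc, coprod.inl_desc_assoc, coprod.inl_desc, ← nilPointedMap_comp,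
        biprod.inl_fst, nilPointedMap_id]
    · rw [nilCoprodDesc, coprod.inr_desc_assoc, coprod.inr_desc, ← nilPointedMap_comp,
        biprod.inl_snd, nilPointedMap_zero p]
  have hr : nilCoprodDesc F ≫ nilPointedMap biprod.inr =
      coprod.desc (p ≫ initial.to _) (𝟙 _) := by
    apply coprod.hom_ext
    · rw [nilCoprodDesc, coprod.inl_desc_assoc, coprod.inl_desc, ← nilPointedMap_comp,
        biprod.inr_fst, nilPointedMap_zero p]
    · rw [nilCoprodDesc, coprod.inr_desc_assoc, coprod.inr_desc, ← nilPointedMap_comp,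
        biprod.inr_snd, nilPointedMap_id]
  have hψ' : ψ = biprod.desc (𝟙 F) (𝟙 F) := by
    apply biprod.hom_ext'
    · apply nilPointedMap_injective
      rw [nilPointedMap_comp, hψ, Category.assoc, hl, h₂, biprod.inl_desc, nilPointedMap_id]
    · apply nilPointedMap_injective
      rw [nilPointedMap_comp, hψ, Category.assoc, hr, h₁, biprod.inr_desc, nilPointedMap_id]
  rw [nilComul, ← hψ', hψ, Category.assoc, IsIso.hom_inv_id, Category.comp_id]

/-- The comultiplication of `Y`, transported along `e`, satisfies the counit axioms on `Nil_X(F)`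
and so equals `nilComul F`. Hence an isomorphism of pointed schemes is already one of cogroups. -/
lemma nilComul_map_iso {Y : PointedOver X} [HasBinaryCoproduct Y Y] [AbCogroupObj Y]
    (e : nilPointed F ≅ Y) :
    nilComul F ≫ coprod.map e.hom e.hom = e.hom ≫ AbCogroupObj.comul := by
  have h : e.hom ≫ AbCogroupObj.comul ≫ coprod.map e.inv e.inv = nilComul F := by
    refine eq_nilComul _ (e.hom ≫ AbCogroupObj.counit) ?_ ?_
    · have := AbCogroupObj.counit_left (Y := Y)
      rw [Category.assoc, Category.assoc, coprod.map_desc, Category.comp_id]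
      have h₁ : coprod.desc (e.inv ≫ (e.hom ≫ AbCogroupObj.counit) ≫ initial.to (nilPointed F))
          e.inv = coprod.desc (AbCogroupObj.counit ≫ initial.to Y) (𝟙 Y) ≫ e.inv := by
        rw [coprod.desc_comp, Category.id_comp, Category.assoc, Category.assoc,
          e.inv_hom_id_assoc, initial.to_comp]
      rw [h₁, reassoc_of% this, e.hom_inv_id]
    · have := AbCogroupObj.counit_right (Y := Y)
      rw [Category.assoc, Category.assoc, coprod.map_desc, Category.comp_id]
      have h₁ : coprod.desc e.inv
          (e.inv ≫ (e.hom ≫ AbCogroupObj.counit) ≫ initial.to (nilPointed F)) =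
            coprod.desc (𝟙 Y) (AbCogroupObj.counit ≫ initial.to Y) ≫ e.inv := by
        rw [coprod.desc_comp, Category.id_comp, Category.assoc, Category.assoc,
          e.inv_hom_id_assoc, initial.to_comp]
      rw [h₁, reassoc_of% this, e.hom_inv_id]
  rw [← h, Category.assoc, Category.assoc, coprod.map_map, e.inv_hom_id, coprod.map_id_id,
    Category.comp_id]

end Uniqueness

/-! ### The ideal of the section of a cogroup has square zero -/

section SquareZero

variable {X : Scheme.{u}} (Y : PointedOver X)

/-- The map through the zero object is the constant map `σπ`; this turns the counit axioms into
statements about the axes of `Y ×_X Y`. -/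
lemma homLeft_counit {T : PointedOver X} (p : Y ⟶ ⊥_ (PointedOver X)) :
    homLeft (p ≫ initial.to T) = Y.toBase ≫ T.sec := by
  have h : p ≫ initial.to T = homOf (T' := pointedZero X) Y.toBase (Category.comp_id _)
      Y.sec_toBase ≫ homOf (T := pointedZero X) T.sec T.sec_toBase (Category.id_comp _) := by
    rw [pointedCounit_unique p (pointedCounit Y), pointedCounit]
    refine (Category.assoc _ _ _).trans ?_
    congr 1
    exact (Under.mkIdInitial (X := Over.mk (𝟙 X))).hom_ext _ _
  rw [h]
  rfl

instance isClosedImmersion_sec [IsSeparated Y.toBase] : IsClosedImmersion Y.sec := by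
  have : IsClosedImmersion (Y.sec ≫ Y.toBase) := by
    rw [sec_toBase]
    infer_instance
  exact .of_comp Y.sec Y.toBase

/-- The map `(1, σ π) : Y ⟶ Y ×_X Y`. -/
def axisFst : Y.toScheme ⟶ pullback Y.toBase Y.toBase :=
  pullback.lift (𝟙 _) (Y.toBase ≫ Y.sec) (by rw [Category.assoc, sec_toBase]; simp)

/-- The map `(σ π, 1) : Y ⟶ Y ×_X Y`. -/
def axisSnd : Y.toScheme ⟶ pullback Y.toBase Y.toBase :=
  pullback.lift (Y.toBase ≫ Y.sec) (𝟙 _) (by rw [Category.assoc, sec_toBase]; simp)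

instance [IsSeparated Y.toBase] : IsClosedImmersion (axisFst Y) := by
  have : IsClosedImmersion (axisFst Y ≫ pullback.fst _ _) := by
    rw [axisFst, pullback.lift_fst]
    infer_instance
  exact .of_comp _ (pullback.fst _ _)

instance [IsSeparated Y.toBase] : IsClosedImmersion (axisSnd Y) := by
  have : IsClosedImmersion (axisSnd Y ≫ pullback.snd _ _) := by
    rw [axisSnd, pullback.lift_snd]
    infer_instance
  exact .of_comp _ (pullback.snd _ _)

/-- Both axes factor through the closed subscheme `Z` cut out by the product of their ideals and
agree on `X`, so they define a map `Y ⨿ Y ⟶ Z`. Composed with the comultiplication it has both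
projections equal to the identity by the counit axioms: the diagonal factors through `Z`. -/
lemma exists_diagonal_factorization [HasBinaryCoproduct Y Y] [AbCogroupObj Y] :
    ∃ d : Y.toScheme ⟶ ((axisFst Y).ker * (axisSnd Y).ker).subscheme,
      d ≫ ((axisFst Y).ker * (axisSnd Y).ker).subschemeι ≫ pullback.fst _ _ = 𝟙 _ ∧
      d ≫ ((axisFst Y).ker * (axisSnd Y).ker).subschemeι ≫ pullback.snd _ _ = 𝟙 _ := by
  set I := (axisFst Y).ker * (axisSnd Y).ker with hI
  have ha : I.subschemeι.ker ≤ (axisFst Y).ker := by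
    rw [I.ker_subschemeι, hI]
    exact fun U => by rw [Scheme.IdealSheafData.ideal_mul]; exact Ideal.mul_le_left
  have hb : I.subschemeι.ker ≤ (axisSnd Y).ker := by
    rw [I.ker_subschemeι, hI]
    exact fun U => by rw [Scheme.IdealSheafData.ideal_mul]; exact Ideal.mul_le_right
  let a := IsClosedImmersion.lift I.subschemeι (axisFst Y) ha
  let b := IsClosedImmersion.lift I.subschemeι (axisSnd Y) hb
  have ha' : a ≫ I.subschemeι = axisFst Y := IsClosedImmersion.lift_fac _ _ _
  have hb' : b ≫ I.subschemeι = axisSnd Y := IsClosedImmersion.lift_fac _ _ _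
  have ha₁ : a ≫ I.subschemeι ≫ pullback.fst _ _ = 𝟙 _ := by
    rw [reassoc_of% ha', axisFst, pullback.lift_fst]
  have ha₂ : a ≫ I.subschemeι ≫ pullback.snd _ _ = Y.toBase ≫ Y.sec := by
    rw [reassoc_of% ha', axisFst, pullback.lift_snd]
  have hb₁ : b ≫ I.subschemeι ≫ pullback.fst _ _ = Y.toBase ≫ Y.sec := by
    rw [reassoc_of% hb', axisSnd, pullback.lift_fst]
  have hb₂ : b ≫ I.subschemeι ≫ pullback.snd _ _ = 𝟙 _ := by
    rw [reassoc_of% hb', axisSnd, pullback.lift_snd]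
  have hsec : Y.sec ≫ Y.toBase ≫ Y.sec = Y.sec := by
    rw [← Category.assoc, sec_toBase, Category.id_comp]
  have hab : Y.sec ≫ b = Y.sec ≫ a := by
    rw [← cancel_mono I.subschemeι, Category.assoc, Category.assoc]
    apply pullback.hom_ext
    · simp only [Category.assoc, ha₁, hb₁, hsec, Category.comp_id]
    · simp only [Category.assoc, ha₂, hb₂, hsec, Category.comp_id]
  -- `Z` is pointed by the common restriction of the two axes to `X`, which makes `a`, `b` and the
  -- two projections pointed morphisms.
  let Z : PointedOver X := of (I.subschemeι ≫ pullback.fst _ _ ≫ Y.toBase) (Y.sec ≫ a) (by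
    simp only [Category.assoc]
    rw [reassoc_of% ha₁, sec_toBase])
  let ua : Y ⟶ Z := homOf (T' := Z) a (by
    change a ≫ I.subschemeι ≫ pullback.fst _ _ ≫ Y.toBase = _
    rw [reassoc_of% ha₁]) rfl
  let ub : Y ⟶ Z := homOf (T' := Z) b (by
    change b ≫ I.subschemeι ≫ pullback.fst _ _ ≫ Y.toBase = _
    rw [reassoc_of% hb₁, sec_toBase, Category.comp_id]) hab
  let p₁ : Z ⟶ Y := homOf (T := Z) (I.subschemeι ≫ pullback.fst _ _) (Category.assoc _ _ _) (by
    change (Y.sec ≫ a) ≫ I.subschemeι ≫ pullback.fst _ _ = _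
    rw [Category.assoc, ha₁, Category.comp_id])
  let p₂ : Z ⟶ Y := homOf (T := Z) (I.subschemeι ≫ pullback.snd _ _)
    ((Category.assoc _ _ _).trans (by rw [← pullback.condition]; rfl)) (by
    change (Y.sec ≫ a) ≫ I.subschemeι ≫ pullback.snd _ _ = _
    rw [Category.assoc, ha₂, hsec])
  have hua₁ : ua ≫ p₁ = 𝟙 Y := PointedOver.hom_ext ha₁
  have hub₂ : ub ≫ p₂ = 𝟙 Y := PointedOver.hom_ext hb₂
  have hua₂ : ua ≫ p₂ = AbCogroupObj.counit ≫ initial.to Y :=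
    PointedOver.hom_ext (ha₂.trans (homLeft_counit Y _).symm)
  have hub₁ : ub ≫ p₁ = AbCogroupObj.counit ≫ initial.to Y :=
    PointedOver.hom_ext (hb₁.trans (homLeft_counit Y _).symm)
  let d : Y ⟶ Z := AbCogroupObj.comul ≫ coprod.desc ua ub
  have hd₁ : d ≫ p₁ = 𝟙 Y := by
    rw [Category.assoc, coprod.desc_comp, hua₁, hub₁, AbCogroupObj.counit_right]
  have hd₂ : d ≫ p₂ = 𝟙 Y := by
    rw [Category.assoc, coprod.desc_comp, hua₂, hub₂, AbCogroupObj.counit_left]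
  exact ⟨homLeft d, congr(homLeft $hd₁), congr(homLeft $hd₂)⟩

variable [IsSeparated Y.toBase]

/-- On the axis `(σπ, 1)` the first projection is `σπ`, so `pr₁^* f` restricts to `π^* σ^* f = 0`.
-/
lemma appLE_mem_ker_axisSnd {V : Y.toScheme.Opens} {f : Γ(Y.toScheme, V)}
    (hf : Y.sec.app V f = 0) (O : (pullback Y.toBase Y.toBase).affineOpens)
    (h : O.1 ≤ pullback.fst Y.toBase Y.toBase ⁻¹ᵁ V) :
    (pullback.fst Y.toBase Y.toBase).appLE V O.1 h f ∈ (axisSnd Y).ker.ideal O := by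
  rw [Scheme.Hom.ker_apply, RingHom.mem_ker]
  have e : axisSnd Y ≫ pullback.fst _ _ = Y.toBase ≫ Y.sec := pullback.lift_fst _ _ _
  have e' : axisSnd Y ⁻¹ᵁ O.1 ≤ Y.toBase ⁻¹ᵁ Y.sec ⁻¹ᵁ V := by
    rw [← Scheme.Hom.comp_preimage, ← e]
    exact fun _ hx => h hx
  have H : (pullback.fst Y.toBase Y.toBase).appLE V O.1 h ≫ (axisSnd Y).app O.1 =
      Y.sec.app V ≫ Y.toBase.appLE _ _ e' := by
    rw [Scheme.Hom.app_eq_appLE, Scheme.Hom.appLE_comp_appLE, Scheme.Hom.app_eq_appLE,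
      Scheme.Hom.appLE_comp_appLE]
    simp only [e]
  refine congr($H f).trans ?_
  rw [CommRingCat.comp_apply, hf, map_zero]

lemma appLE_mem_ker_axisFst {V : Y.toScheme.Opens} {f : Γ(Y.toScheme, V)}
    (hf : Y.sec.app V f = 0) (O : (pullback Y.toBase Y.toBase).affineOpens)
    (h : O.1 ≤ pullback.snd Y.toBase Y.toBase ⁻¹ᵁ V) :
    (pullback.snd Y.toBase Y.toBase).appLE V O.1 h f ∈ (axisFst Y).ker.ideal O := by
  rw [Scheme.Hom.ker_apply, RingHom.mem_ker]
  have e : axisFst Y ≫ pullback.snd _ _ = Y.toBase ≫ Y.sec := pullback.lift_snd _ _ _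
  have e' : axisFst Y ⁻¹ᵁ O.1 ≤ Y.toBase ⁻¹ᵁ Y.sec ⁻¹ᵁ V := by
    rw [← Scheme.Hom.comp_preimage, ← e]
    exact fun _ hx => h hx
  have H : (pullback.snd Y.toBase Y.toBase).appLE V O.1 h ≫ (axisFst Y).app O.1 =
      Y.sec.app V ≫ Y.toBase.appLE _ _ e' := by
    rw [Scheme.Hom.app_eq_appLE, Scheme.Hom.appLE_comp_appLE, Scheme.Hom.app_eq_appLE,
      Scheme.Hom.appLE_comp_appLE]
    simp only [e]
  refine congr($H f).trans ?_
  rw [CommRingCat.comp_apply, hf, map_zero]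

variable [HasBinaryCoproduct Y Y] [AbCogroupObj Y]

/-- The product of `pr₂^* g` and `pr₁^* f` lies in the product of the ideals of the axes, so it dies
on the subscheme through which the diagonal factors; its pullback along the diagonal is `f g`. -/
lemma mul_eq_zero_of_sec_eq_zero {V : Y.toScheme.Opens} (f g : Γ(Y.toScheme, V))
    (hf : Y.sec.app V f = 0) (hg : Y.sec.app V g = 0) : f * g = 0 := by
  obtain ⟨I, hI, d, h₁, h₂⟩ : ∃ I, I = (axisFst Y).ker * (axisSnd Y).ker ∧
      ∃ d : Y.toScheme ⟶ I.subscheme, d ≫ I.subschemeι ≫ pullback.fst _ _ = 𝟙 _ ∧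
        d ≫ I.subschemeι ≫ pullback.snd _ _ = 𝟙 _ :=
    ⟨_, rfl, exists_diagonal_factorization Y⟩
  let Δ := d ≫ I.subschemeι
  have h₁' : Δ ≫ pullback.fst _ _ = 𝟙 _ := (Category.assoc _ _ _).trans h₁
  have h₂' : Δ ≫ pullback.snd _ _ = 𝟙 _ := (Category.assoc _ _ _).trans h₂
  have key (O : (pullback Y.toBase Y.toBase).affineOpens)
      (hO₁ : O.1 ≤ pullback.fst Y.toBase Y.toBase ⁻¹ᵁ V)
      (hO₂ : O.1 ≤ pullback.snd Y.toBase Y.toBase ⁻¹ᵁ V) (h : Δ ⁻¹ᵁ O.1 ≤ V) :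
      Y.toScheme.presheaf.map (homOfLE h).op (f * g) = 0 := by
    have hm := Ideal.mul_mem_mul (appLE_mem_ker_axisFst Y hg O hO₂)
      (appLE_mem_ker_axisSnd Y hf O hO₁)
    have hm' : I.subschemeι.app O.1 ((pullback.snd Y.toBase Y.toBase).appLE V O.1 hO₂ g *
        (pullback.fst Y.toBase Y.toBase).appLE V O.1 hO₁ f) = 0 := by
      rw [← RingHom.mem_ker, I.ker_subschemeι_app, hI]
      exact hm
    have hm'' : Δ.app O.1 ((pullback.snd Y.toBase Y.toBase).appLE V O.1 hO₂ g *
        (pullback.fst Y.toBase Y.toBase).appLE V O.1 hO₁ f) = 0 :=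
      congr($(Scheme.Hom.comp_app d I.subschemeι O.1) _).trans
        ((congr_arg (d.app _) hm').trans (map_zero (d.app (I.subschemeι ⁻¹ᵁ O.1)).hom))
    have e₁ : (pullback.fst Y.toBase Y.toBase).appLE V O.1 hO₁ ≫ Δ.app O.1 =
        Y.toScheme.presheaf.map (homOfLE h).op := by
      rw [Scheme.Hom.app_eq_appLE, Scheme.Hom.appLE_comp_appLE]
      simp only [h₁']
      exact Category.id_comp _
    have e₂ : (pullback.snd Y.toBase Y.toBase).appLE V O.1 hO₂ ≫ Δ.app O.1 =
        Y.toScheme.presheaf.map (homOfLE h).op := by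
      rw [Scheme.Hom.app_eq_appLE, Scheme.Hom.appLE_comp_appLE]
      simp only [h₂']
      exact Category.id_comp _
    rw [map_mul, ← CommRingCat.comp_apply, ← CommRingCat.comp_apply, e₁, e₂] at hm''
    rw [map_mul, mul_comm, hm'']
  -- The ideals are described on affine opens, so the vanishing is checked on preimages of affine
  -- neighbourhoods of the points `Δ y`.
  have hx (y : V) : ∃ O : (pullback Y.toBase Y.toBase).affineOpens, Δ y.1 ∈ O.1 ∧
      O.1 ≤ pullback.fst Y.toBase Y.toBase ⁻¹ᵁ V ∧ O.1 ≤ pullback.snd Y.toBase Y.toBase ⁻¹ᵁ V := by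
    have m₁ : Δ y.1 ∈ pullback.fst Y.toBase Y.toBase ⁻¹ᵁ V := by
      change (pullback.fst Y.toBase Y.toBase) (Δ y.1) ∈ V
      rw [← Scheme.Hom.comp_apply, h₁']
      exact y.2
    have m₂ : Δ y.1 ∈ pullback.snd Y.toBase Y.toBase ⁻¹ᵁ V := by
      change (pullback.snd Y.toBase Y.toBase) (Δ y.1) ∈ V
      rw [← Scheme.Hom.comp_apply, h₂']
      exact y.2
    obtain ⟨O, hO, hyO, hOV⟩ := exists_isAffineOpen_mem_and_subset (x := Δ y.1)
      (U := pullback.fst Y.toBase Y.toBase ⁻¹ᵁ V ⊓ pullback.snd Y.toBase Y.toBase ⁻¹ᵁ V) ⟨m₁, m₂⟩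
    exact ⟨⟨O, hO⟩, hyO, fun _ hz => (hOV hz).1, fun _ hz => (hOV hz).2⟩
  choose O hyO hO₁ hO₂ using hx
  have hle (y : V) : Δ ⁻¹ᵁ (O y).1 ≤ V := fun z hz => by
    have : pullback.fst Y.toBase Y.toBase (Δ z) ∈ V := hO₁ y hz
    rw [← Scheme.Hom.comp_apply, h₁'] at this
    exact this
  refine TopCat.Sheaf.eq_of_locally_eq' Y.toScheme.sheaf (fun y : V => Δ ⁻¹ᵁ (O y).1) V
    (fun y => homOfLE (hle y)) (fun y hy => Opens.mem_iSup.mpr ⟨⟨y, hy⟩, hyO ⟨y, hy⟩⟩) _ _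
    fun y => ?_
  exact (key (O y) (hO₁ y) (hO₂ y) (hle y)).trans (map_zero (Y.toScheme.presheaf.map _).hom).symm

/-- On the open complement of the closed image of the section, the function `1` vanishes along the
section. So `1 = 1 * 1 = 0` there and the complement is empty. -/
lemma sec_surjective : Function.Surjective Y.sec := by
  intro y
  by_contra hy
  let U : Y.toScheme.Opens := ⟨(Set.range Y.sec)ᶜ,
    Y.sec.isClosedEmbedding.isClosed_range.isOpen_compl⟩
  have hU : Y.sec ⁻¹ᵁ U = ⊥ := by
    ext x
    exact iff_of_false (fun h => h ⟨x, rfl⟩) id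
  have h₁ : Y.sec.app U 1 = 0 := by
    have : Subsingleton Γ(X, Y.sec ⁻¹ᵁ U) := by rw [hU]; infer_instance
    exact Subsingleton.elim _ _
  have h₂ := mul_eq_zero_of_sec_eq_zero Y (1 : Γ(Y.toScheme, U)) 1 h₁ h₁
  have h₃ := Y.toScheme.basicOpen_zero U
  rw [← h₂, mul_one, Scheme.basicOpen_of_isUnit _ isUnit_one] at h₃
  have : y ∈ U := hy
  rw [h₃] at this
  exact this

/-- For an affine neighbourhood `V` of `σ x`, the open `σ⁻¹ V` is affine because `σ` is a closed
immersion, and its preimage under `π` is `V` again. -/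
instance isAffineHom_toBase : IsAffineHom Y.toBase := by
  refine isAffineHom_of_forall_exists_isAffineOpen _ fun x => ?_
  obtain ⟨V, hV, hxV, -⟩ := exists_isAffineOpen_mem_and_subset (x := Y.sec x) (U := ⊤) trivial
  refine ⟨Y.sec ⁻¹ᵁ V, hxV, hV.preimage Y.sec, ?_⟩
  rw [preimage_preimage_of_surjective Y.sec_toBase (sec_surjective Y)]
  exact hV

end SquareZero

/-! ### The augmentation ideal of a pointed scheme -/

section Augmentation

variable {X : Scheme.{u}} (Y : PointedOver X)

lemma le_sec_preimage (U : X.Opens) : U ≤ Y.sec ⁻¹ᵁ Y.toBase ⁻¹ᵁ U := by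
  rw [← Scheme.Hom.comp_preimage, sec_toBase]
  rfl

/-- The restriction `Γ(Y, π⁻¹ U) ⟶ Γ(X, U)` along the section. -/
def augmentation (U : X.Opens) : Γ(Y.toScheme, Y.toBase ⁻¹ᵁ U) ⟶ Γ(X, U) :=
  Y.sec.appLE (Y.toBase ⁻¹ᵁ U) U (le_sec_preimage Y U)

lemma toBase_augmentation (U : X.Opens) (b : Γ(X, U)) :
    augmentation Y U (Y.toBase.app U b) = b := by
  have : Y.toBase.app U ≫ augmentation Y U = 𝟙 _ := by
    rw [augmentation, Scheme.Hom.app_eq_appLE, Scheme.Hom.appLE_comp_appLE]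
    simp only [sec_toBase]
    exact (Category.id_comp _).trans (X.presheaf.map_id _)
  exact congr($this b)

lemma augmentation_map {U W : X.Opens} (h : W ≤ U) (h' : Y.toBase ⁻¹ᵁ W ≤ Y.toBase ⁻¹ᵁ U)
    (a : Γ(Y.toScheme, Y.toBase ⁻¹ᵁ U)) :
    augmentation Y W (Y.toScheme.presheaf.map (homOfLE h').op a) =
      X.presheaf.map (homOfLE h).op (augmentation Y U a) := by
  have : Y.toScheme.presheaf.map (homOfLE h').op ≫ augmentation Y W =
      augmentation Y U ≫ X.presheaf.map (homOfLE h).op := by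
    rw [augmentation, augmentation, Scheme.Hom.map_appLE, Scheme.Hom.appLE_map]
  exact congr($this a)

lemma toBase_map {U W : X.Opens} (h : W ≤ U) (h' : Y.toBase ⁻¹ᵁ W ≤ Y.toBase ⁻¹ᵁ U)
    (b : Γ(X, U)) :
    Y.toScheme.presheaf.map (homOfLE h').op (Y.toBase.app U b) =
      Y.toBase.app W (X.presheaf.map (homOfLE h).op b) :=
  congr($(Y.toBase.naturality (homOfLE h).op) b).symm

/-- The kernel of `Γ(Y, π⁻¹ U) ⟶ Γ(X, U)`. -/
def augIdeal (U : X.Opens) : Ideal Γ(Y.toScheme, Y.toBase ⁻¹ᵁ U) :=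
  RingHom.ker (augmentation Y U).hom

lemma mem_augIdeal {U : X.Opens} {a : Γ(Y.toScheme, Y.toBase ⁻¹ᵁ U)} :
    a ∈ augIdeal Y U ↔ augmentation Y U a = 0 := RingHom.mem_ker

/-- The presheaf of abelian groups `U ↦ ker (Γ(Y, π⁻¹ U) ⟶ Γ(X, U))`. -/
def augPresheaf : X.Opensᵒᵖ ⥤ Ab.{u} where
  obj U := .of (augIdeal Y U.unop)
  map {U W} i := AddCommGrpCat.ofHom
    (AddMonoidHom.mk' (fun (a : augIdeal Y U.unop) =>
      (⟨Y.toScheme.presheaf.map ((Opens.map Y.toBase.base).map i.unop).op a.1,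
        (mem_augIdeal Y).mpr ((augmentation_map Y i.unop.le _ a.1).trans
          ((congr_arg _ a.2).trans (map_zero (X.presheaf.map i).hom)))⟩ : augIdeal Y W.unop))
      fun a b => Subtype.ext (map_add (Y.toScheme.presheaf.map _).hom a.1 b.1))
  map_id U := AddCommGrpCat.hom_ext <| AddMonoidHom.ext fun a : augIdeal Y U.unop =>
    Subtype.ext congr($(Y.toScheme.presheaf.map_id (op (Y.toBase ⁻¹ᵁ U.unop))) a.1)
  map_comp i j := AddCommGrpCat.hom_ext <| AddMonoidHom.ext fun a : augIdeal Y _ =>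
    Subtype.ext congr($(Y.toScheme.presheaf.map_comp
      ((Opens.map Y.toBase.base).map i.unop).op ((Opens.map Y.toBase.base).map j.unop).op) a.1)

instance augPresheafModule (U : X.Opensᵒᵖ) :
    Module (X.ringCatSheaf.obj.obj U) ((augPresheaf Y).obj U) :=
  (Module.compHom (augIdeal Y U.unop) (Y.toBase.app U.unop).hom :
    Module Γ(X, U.unop) (augIdeal Y U.unop))

/-- Sections glue as functions on `Y`, and the vanishing of the augmentation can be tested locally
on `X`. -/
lemma isSheaf_augPresheaf : TopCat.Presheaf.IsSheaf (augPresheaf Y) := by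
  rw [TopCat.Presheaf.isSheaf_iff_isSheaf_comp (forget Ab)]
  rw [TopCat.Presheaf.isSheaf_iff_isSheafUniqueGluing_types]
  intro ι U sf hsf
  obtain ⟨a, ha, ha'⟩ := Y.toScheme.sheaf.existsUnique_gluing' (fun i => Y.toBase ⁻¹ᵁ U i)
    (Y.toBase ⁻¹ᵁ iSup U) (fun i => homOfLE fun _ hx => Opens.mem_iSup.mpr ⟨i, hx⟩)
    (fun x hx => Opens.mem_iSup.mpr (by
      obtain ⟨i, hi⟩ := Opens.mem_iSup.mp (show Y.toBase x ∈ iSup U from hx)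
      exact ⟨i, hi⟩))
    (fun i => (show augIdeal Y (U i) from sf i).1) (fun i j => congr_arg Subtype.val (hsf i j))
  have hm : augmentation Y (iSup U) a = 0 := by
    refine X.sheaf.eq_of_locally_eq U _ _ fun i => ?_
    refine (augmentation_map Y (le_iSup U i)
      (fun _ hx => Opens.mem_iSup.mpr ⟨i, hx⟩) a).symm.trans ?_
    refine (congr_arg (augmentation Y (U i)) (ha i)).trans ?_
    exact (show augIdeal Y (U i) from sf i).2.trans (map_zero (X.presheaf.map _).hom).symm
  exact ⟨(⟨a, hm⟩ : augIdeal Y (iSup U)), fun i => Subtype.ext (ha i), fun b hb =>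
    Subtype.ext (ha' _ fun i => congr_arg Subtype.val (hb i))⟩

/-- The augmentation ideal of a pointed scheme `Y` over `X`, as an `𝒪_X`-module. -/
def augModule : X.Modules where
  val := PresheafOfModules.ofPresheaf (augPresheaf Y) fun _ _ i r _ =>
    Subtype.ext (show _ from (map_mul (Y.toScheme.presheaf.map _).hom _ _).trans
      (congr_arg (· * _) (toBase_map Y i.unop.le _ r)))
  isSheaf := isSheaf_augPresheaf Y

/-- A section of `augModule Y`, as a function on `Y`. -/
def augVal {U : X.Opens} (m : Γ(augModule Y, U)) : Γ(Y.toScheme, Y.toBase ⁻¹ᵁ U) :=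
  (show augIdeal Y U from m).1

/-- The section of `augModule Y` given by a function on `Y`. -/
def augMk {U : X.Opens} (a : Γ(Y.toScheme, Y.toBase ⁻¹ᵁ U)) (ha : augmentation Y U a = 0) :
    Γ(augModule Y, U) := (⟨a, ha⟩ : augIdeal Y U)

variable {Y} {U W : X.Opens}

lemma augVal_augMk (a : Γ(Y.toScheme, Y.toBase ⁻¹ᵁ U)) (ha : augmentation Y U a = 0) :
    augVal Y (augMk Y a ha) = a := rfl

lemma augVal_injective {m n : Γ(augModule Y, U)} (h : augVal Y m = augVal Y n) : m = n :=
  Subtype.ext h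

lemma augmentation_augVal (m : Γ(augModule Y, U)) : augmentation Y U (augVal Y m) = 0 :=
  (show augIdeal Y U from m).2

lemma augVal_add (m n : Γ(augModule Y, U)) : augVal Y (m + n) = augVal Y m + augVal Y n := rfl

lemma augVal_zero : augVal Y (0 : Γ(augModule Y, U)) = 0 := rfl

lemma augVal_smul (b : Γ(X, U)) (m : Γ(augModule Y, U)) :
    augVal Y (b • m) = Y.toBase.app U b * augVal Y m := rfl

lemma augVal_map (h : W ≤ U) (h' : Y.toBase ⁻¹ᵁ W ≤ Y.toBase ⁻¹ᵁ U) (m : Γ(augModule Y, U)) :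
    augVal Y ((augModule Y).presheaf.map (homOfLE h).op m) =
      Y.toScheme.presheaf.map (homOfLE h').op (augVal Y m) := rfl

end Augmentation

lemma sections_map_map (Y : Scheme.{u}) {U V W : Y.Opens} (h : W ≤ V) (h' : V ≤ U) (a : Γ(Y, U)) :
    Y.presheaf.map (homOfLE h).op (Y.presheaf.map (homOfLE h').op a) =
      Y.presheaf.map (homOfLE (h.trans h')).op a := by
  rw [← ConcreteCategory.comp_apply, ← Y.presheaf.map_comp]; rfl

lemma sections_map_self (Y : Scheme.{u}) {U : Y.Opens} (h : U ≤ U) (a : Γ(Y, U)) :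
    Y.presheaf.map (homOfLE h).op a = a :=
  congr($(Y.presheaf.map_id (op U)) a)

/-! ### Quasi-coherence of the augmentation ideal -/

section Quasicoherent

variable {X : Scheme.{u}}

/-- The converse of `exists_and_eq_zero`. -/
lemma isQuasicoherent_of_exists_and_eq_zero (F : X.Modules)
    (h : ∀ (U : X.Opens) (_ : IsAffineOpen U) (f : Γ(X, U)),
      (∀ s : Γ(F, X.basicOpen f), ∃ (n : ℕ) (t : Γ(F, U)),
        F.presheaf.map (homOfLE (X.basicOpen_le f)).op t =
          (X.presheaf.map (homOfLE (X.basicOpen_le f)).op f) ^ n • s) ∧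
      (∀ t : Γ(F, U), F.presheaf.map (homOfLE (X.basicOpen_le f)).op t = 0 →
        ∃ n : ℕ, f ^ n • t = 0)) : F.IsQuasicoherent := by
  refine isQuasicoherent_of_affine _ fun U hU => ?_
  have hI : IsIso (F.restrict hU.fromSpec).fromTildeΓ := by
    refine (isIso_fromTildeΓ_iff_isLocalizing _).mpr fun f => ?_
    obtain ⟨hs, hz⟩ := h U hU f
    have e1 : hU.fromSpec ''ᵁ ⊤ = U := by simp
    let D : (Spec Γ(X, U)).Opens := PrimeSpectrum.basicOpen f
    have e2 : hU.fromSpec ''ᵁ D = X.basicOpen f := hU.fromSpec_image_basicOpen f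
    have e3 : hU.fromSpec ''ᵁ D ≤ U := e2 ▸ X.basicOpen_le f
    have e4 : hU.fromSpec ''ᵁ D ≤ hU.fromSpec ''ᵁ ⊤ := e3.trans e1.ge
    refine ⟨?_, fun y => ?_, fun {x₁ x₂} hx => ?_⟩
    -- Of the three localization conditions, invertibility of `f` on `D(f)` holds for every module.
    · rw [Subtype.forall]
      change Submonoid.powers _ ≤ (IsUnit.submonoid _).comap _
      rw [Submonoid.powers_le, Submonoid.mem_comap]
      exact Scheme.Modules.isUnit_algebraMap_end_of_le_basicOpen f le_rfl
    · let y' : Γ(F, hU.fromSpec ''ᵁ D) := y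
      obtain ⟨n, t, ht⟩ := hs (F.presheaf.map (homOfLE e2.ge).op y')
      refine ⟨(F.presheaf.map (homOfLE e1.le).op t, ⟨_, n, rfl⟩), ?_⟩
      refine (smul_restrict_fromSpec F hU (f ^ n) D e3 y).trans ?_
      change X.presheaf.map (homOfLE e3).op (f ^ n) • y' =
        F.presheaf.map (homOfLE e4).op (F.presheaf.map (homOfLE e1.le).op t)
      have := congr(F.presheaf.map (homOfLE e2.le).op $ht)
      rw [Scheme.Modules.map_smul, modules_map_map, modules_map_map, modules_map_self, map_pow,
        ← ConcreteCategory.comp_apply, ← X.presheaf.map_comp] at this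
      rw [modules_map_map, map_pow]
      exact this.symm
    · let x : Γ(F, hU.fromSpec ''ᵁ ⊤) := x₁ - x₂
      have hx' : F.presheaf.map (homOfLE e4).op x = 0 :=
        (map_sub (F.presheaf.map (homOfLE e4).op).hom x₁ x₂).trans (sub_eq_zero.mpr hx)
      obtain ⟨n, hn⟩ := hz (F.presheaf.map (homOfLE e1.ge).op x) (by
        have := congr(F.presheaf.map (homOfLE e2.ge).op $hx')
        rw [modules_map_map, map_zero] at this
        rwa [modules_map_map])
      refine ⟨⟨_, n, rfl⟩, sub_eq_zero.mp ((smul_sub _ x₁ x₂).symm.trans ?_)⟩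
      refine (smul_restrict_fromSpec F hU (f ^ n) ⊤ e1.le (x₁ - x₂)).trans ?_
      change X.presheaf.map (homOfLE e1.le).op (f ^ n) • x = 0
      have := congr(F.presheaf.map (homOfLE e1.le).op $hn)
      rwa [Scheme.Modules.map_smul, modules_map_map, modules_map_self, map_zero] at this
  obtain ⟨M, ⟨e⟩⟩ := isIso_fromTildeΓ_iff.mp hI
  have he : IsIso e.hom := inferInstance
  exact ⟨@SheafOfModules.Presentation.ofIsIso.{u, u, u} _ _ _ _ _ _ _ _ e.hom he
    (presentationTilde.{u} M .univ (by simp) _ (Submodule.span_eq _))⟩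

variable (Y : PointedOver X)

/-- Both `Γ(Y, π⁻¹ U)` and `Γ(X, U)` localize correctly when `U` is affine, hence so does the kernel
of the augmentation between them. -/
lemma isQuasicoherent_augModule [IsAffineHom Y.toBase] : (augModule Y).IsQuasicoherent := by
  refine isQuasicoherent_of_exists_and_eq_zero _ fun U hU f => ?_
  have hV : IsAffineOpen (Y.toBase ⁻¹ᵁ U) := hU.preimage Y.toBase
  let g := Y.toBase.app U f
  have hg : Y.toBase ⁻¹ᵁ X.basicOpen f = Y.toScheme.basicOpen g := Scheme.preimage_basicOpen _ _
  have hle := X.basicOpen_le f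
  have hle' : Y.toBase ⁻¹ᵁ X.basicOpen f ≤ Y.toBase ⁻¹ᵁ U := fun _ hx => hle hx
  have hgf : Y.toScheme.presheaf.map (homOfLE hle').op g =
      Y.toBase.app (X.basicOpen f) (X.presheaf.map (homOfLE hle).op f) := toBase_map Y hle hle' f
  constructor
  · intro s
    obtain ⟨n, t, ht⟩ := exists_eq_pow_mul_of_isAffineOpen Y.toScheme _ hV g
      (Y.toScheme.presheaf.map (homOfLE hg.ge).op (augVal Y s))
    have ht' : Y.toScheme.presheaf.map (homOfLE hle').op t =
        Y.toBase.app (X.basicOpen f) (X.presheaf.map (homOfLE hle).op f) ^ n * augVal Y s := by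
      have := congr(Y.toScheme.presheaf.map (homOfLE hg.le).op $ht)
      rw [map_mul, map_pow, sections_map_map, sections_map_self] at this
      refine (sections_map_map _ hg.le (Y.toScheme.basicOpen_le g) t).symm.trans (this.trans ?_)
      rw [← hgf]
      exact congr_arg (· ^ n * augVal Y s)
        (sections_map_map _ hg.le (Y.toScheme.basicOpen_le g) g)
    -- The extension `t` of `f ^ n • s` has augmentation vanishing only on `D(f)`; a further power
    -- `f ^ m` moves it into the kernel, whence the exponent `m + n`.
    have hz : X.presheaf.map (homOfLE hle).op (augmentation Y U t) = 0 := by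
      rw [← augmentation_map Y hle hle', ht', map_mul, augmentation_augVal, mul_zero]
    obtain ⟨m, hm⟩ := exists_pow_mul_eq_zero_of_res_basicOpen_eq_zero_of_isCompact X
      hU.isCompact _ f hz
    refine ⟨m + n, augMk Y (g ^ m * t) ?_, augVal_injective ?_⟩
    · rw [map_mul, map_pow, toBase_augmentation, hm]
    · rw [augVal_map hle hle', augVal_augMk, map_mul, ht', map_pow, hgf, augVal_smul, map_pow,
        pow_add, mul_assoc]
  · intro t ht
    have ht' : Y.toScheme.presheaf.map (homOfLE hle').op (augVal Y t) = 0 := congr(augVal Y $ht)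
    obtain ⟨n, hn⟩ := exists_pow_mul_eq_zero_of_res_basicOpen_eq_zero_of_isCompact Y.toScheme
      hV.isCompact (augVal Y t) g (by
        refine (sections_map_map _ hg.ge hle' _).symm.trans ?_
        rw [ht', map_zero])
    refine ⟨n, augVal_injective ?_⟩
    rw [augVal_smul, map_pow, hn]
    rfl

end Quasicoherent

/-! ### Reconstruction of a pointed scheme from its augmentation ideal -/

section Reconstruction

variable {X : Scheme.{u}} (Y : PointedOver X)

lemma sec_app_eq_zero {U : X.Opens} {a : Γ(Y.toScheme, Y.toBase ⁻¹ᵁ U)}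
    (ha : augmentation Y U a = 0) : Y.sec.app (Y.toBase ⁻¹ᵁ U) a = 0 := by
  have e : Y.sec ⁻¹ᵁ Y.toBase ⁻¹ᵁ U ≤ U := by
    rw [← Scheme.Hom.comp_preimage, sec_toBase]
    rfl
  have : augmentation Y U ≫ X.presheaf.map (homOfLE e).op = Y.sec.app (Y.toBase ⁻¹ᵁ U) := by
    rw [augmentation, Scheme.Hom.appLE_map, Scheme.Hom.app_eq_appLE]
  rw [← this, CommRingCat.comp_apply, ha, map_zero]

lemma augmentation_restrict {V : Y.toScheme.Opens} (h : Y.toBase ⁻¹ᵁ Y.sec ⁻¹ᵁ V ≤ V)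
    (a : Γ(Y.toScheme, V)) :
    augmentation Y (Y.sec ⁻¹ᵁ V) (Y.toScheme.presheaf.map (homOfLE h).op a) = Y.sec.app V a := by
  have : Y.toScheme.presheaf.map (homOfLE h).op ≫ augmentation Y (Y.sec ⁻¹ᵁ V) =
      Y.sec.app V := by
    rw [augmentation, Scheme.Hom.map_appLE, Scheme.Hom.app_eq_appLE]
  exact congr($this a)

variable {Y}

/-- Isomorphisms of presheafed spaces are detected on components, and the forgetful functors from
schemes down to presheafed spaces reflect isomorphisms. -/
lemma isIso_of_isIso_base_of_isIso_app {S T : Scheme.{u}} (f : S ⟶ T) (h₀ : IsIso f.base)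
    (h : ∀ V, IsIso (f.app V)) : IsIso f := by
  let f₀ : S.toPresheafedSpace ⟶ T.toPresheafedSpace := f.toPshHom
  have h₁ : IsIso f₀.base := h₀
  have h₂ (V : T.Opensᵒᵖ) : IsIso (f₀.c.app V) := h V.unop
  have h₃ : IsIso f₀.c := @NatIso.isIso_of_isIso_app _ _ _ _ _ _ f₀.c h₂
  have h₄ : IsIso f₀ := PresheafedSpace.isIso_of_components _
  have h₅ : IsIso ((Scheme.forgetToLocallyRingedSpace ⋙
    LocallyRingedSpace.forgetToSheafedSpace).map f) :=
    @isIso_of_reflects_iso _ _ _ _ _ _ _ SheafedSpace.forgetToPresheafedSpace h₄ _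
  have h₆ : IsIso (Scheme.forgetToLocallyRingedSpace.map f) :=
    @isIso_of_reflects_iso _ _ _ _ _ _ _ LocallyRingedSpace.forgetToSheafedSpace h₅ _
  exact isIso_of_reflects_iso f Scheme.forgetToLocallyRingedSpace

/-- The derivation `a ↦ a - π^* σ^* a` with values in the augmentation ideal. -/
def augDer (V : Y.toScheme.Opens) (h : Y.toBase ⁻¹ᵁ Y.sec ⁻¹ᵁ V ≤ V) (a : Γ(Y.toScheme, V)) :
    Γ(augModule Y, Y.sec ⁻¹ᵁ V) :=
  augMk Y (Y.toScheme.presheaf.map (homOfLE h).op a -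
    Y.toBase.app (Y.sec ⁻¹ᵁ V) (Y.sec.app V a)) (by
      rw [map_sub, augmentation_restrict, toBase_augmentation, sub_self])

lemma augVal_augDer (V : Y.toScheme.Opens) (h : Y.toBase ⁻¹ᵁ Y.sec ⁻¹ᵁ V ≤ V)
    (a : Γ(Y.toScheme, V)) :
    augVal Y (augDer V h a) = Y.toScheme.presheaf.map (homOfLE h).op a -
      Y.toBase.app (Y.sec ⁻¹ᵁ V) (Y.sec.app V a) := rfl

/-- The splitting `𝒪_Y = 𝒪_X ⊕ ker σ^*`; the inverse sends `(b, m)` to `π^* b + m`. -/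
lemma augDer_bijective (V : Y.toScheme.Opens) (h : Y.toBase ⁻¹ᵁ Y.sec ⁻¹ᵁ V = V) :
    Function.Bijective fun a : Γ(Y.toScheme, V) => (Y.sec.app V a, augDer V h.le a) := by
  constructor
  · intro a b hab
    obtain ⟨h₁, h₂⟩ := Prod.mk.inj hab
    have h₃ := congr(augVal Y $h₂)
    rw [augVal_augDer, augVal_augDer, h₁, sub_left_inj] at h₃
    have := congr(Y.toScheme.presheaf.map (homOfLE h.ge).op $h₃)
    rwa [sections_map_map, sections_map_map, sections_map_self, sections_map_self] at this
  · rintro ⟨b, m⟩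
    let c := Y.toBase.app (Y.sec ⁻¹ᵁ V) b + augVal Y m
    have hc : Y.toScheme.presheaf.map (homOfLE h.le).op
        (Y.toScheme.presheaf.map (homOfLE h.ge).op c) = c := by
      rw [sections_map_map, sections_map_self]
    have hb : Y.sec.app V (Y.toScheme.presheaf.map (homOfLE h.ge).op c) = b := by
      rw [← augmentation_restrict Y h.le, hc, map_add, toBase_augmentation, augmentation_augVal,
        add_zero]
    refine ⟨Y.toScheme.presheaf.map (homOfLE h.ge).op c, Prod.ext hb (augVal_injective ?_)⟩
    rw [augVal_augDer, hc, hb, add_sub_cancel_left]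

/-- When the augmentation ideal has square zero, `a ↦ a - π^* σ^* a` is a derivation and so defines
a morphism from `Nil_X` of that ideal to `Y`. It is a homeomorphism since both sections are
surjective, and it is bijective on functions by `augDer_bijective`. -/
lemma exists_nilPointed_iso (hs : Function.Surjective Y.sec) [(augModule Y).IsQuasicoherent]
    (hsq : ∀ (U : X.Opens) (m n : Γ(augModule Y, U)), augVal Y m * augVal Y n = 0) :
    Nonempty (nilPointed (augModule Y) ≅ Y) := by
  have hV (V : Y.toScheme.Opens) : Y.toBase ⁻¹ᵁ Y.sec ⁻¹ᵁ V = V :=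
    preimage_preimage_of_surjective Y.sec_toBase hs V
  obtain ⟨f, hf⟩ := exists_nilHom (F := augModule Y) (T := Y) (fun V a => augDer V (hV V).le a)
    (fun V a b => augVal_injective (by
      simp only [augVal_augDer, augVal_add, map_add]
      ring))
    (fun V a b => augVal_injective (by
      -- With `a₀ = π^* σ^* a` and `b₀ = π^* σ^* b`, expanding `(a - a₀) (b - b₀) = 0` gives the
      -- Leibniz rule `a b - a₀ b₀ = a₀ (b - b₀) + b₀ (a - a₀)`.
      have := hsq _ (augDer V (hV V).le a) (augDer V (hV V).le b)
      simp only [augVal_augDer, augVal_add, augVal_smul, map_mul] at this ⊢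
      linear_combination this))
    (fun V W h h' a => augVal_injective (by
      have e : Y.toBase ⁻¹ᵁ Y.sec ⁻¹ᵁ W ≤ Y.toBase ⁻¹ᵁ Y.sec ⁻¹ᵁ V := fun _ hx => h' hx
      rw [augVal_map h' e, augVal_augDer, augVal_augDer, map_sub, sections_map_map,
        sections_map_map, toBase_map Y h' e]
      congr 2
      exact congr($(Y.sec.naturality (homOfLE h).op) a).symm))
    (fun U b => augVal_injective (by
      have e : Y.sec ⁻¹ᵁ Y.toBase ⁻¹ᵁ U ≤ U := by
        rw [← Scheme.Hom.comp_preimage, sec_toBase]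
        rfl
      rw [augVal_augDer, toBase_map Y e, augVal_zero, sub_eq_zero]
      congr 1
      have : Y.toBase.app U ≫ Y.sec.app (Y.toBase ⁻¹ᵁ U) = X.presheaf.map (homOfLE e).op := by
        rw [← Scheme.Hom.comp_app, Scheme.Hom.app_eq_appLE]
        simp only [sec_toBase]
        exact Category.id_comp _
      exact congr($this b).symm))
  have hbase : IsIso (nilHomLeft f).base := by
    -- Both spaces are identified with `X` by their structure maps and sections, so the inverse goes
    -- through `X`.
    refine ⟨Y.toBase.base ≫ (nilSection (augModule Y)).base, ?_, ?_⟩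
    · refine TopCat.ext fun y => ?_
      change nilSection _ (Y.toBase (nilHomLeft f y)) = y
      have h : Y.toBase (nilHomLeft f y) = nilToBase (augModule Y) y :=
        congr($(nilHomLeft_toBase f) y)
      rw [h]
      exact section_apply_of_surjective (nilSection_nilToBase _) (nilSection_surjective _) y
    · refine TopCat.ext fun y => ?_
      change nilHomLeft f (nilSection _ (Y.toBase y)) = y
      rw [← Scheme.Hom.comp_apply, nilSection_nilHomLeft]
      exact section_apply_of_surjective Y.sec_toBase hs y
  have happ (V : Y.toScheme.Opens) : IsIso ((nilHomLeft f).app V) := by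
    have h₁ : Function.Bijective (nilHomSections f V (Y.sec ⁻¹ᵁ V) le_rfl) := by
      have : ⇑(ConcreteCategory.hom (nilHomSections f V (Y.sec ⁻¹ᵁ V) le_rfl)) =
          fun a => ((Y.sec.app V a, augDer V (hV V).le a) :
            TrivSqZeroExt Γ(X, Y.sec ⁻¹ᵁ V) Γ(augModule Y, Y.sec ⁻¹ᵁ V)) := funext fun a => by
        refine (nilHomSections_apply f V _ le_rfl a).trans (Prod.ext ?_ ?_)
        · exact congr($(Y.sec.app_eq_appLE) a).symm
        · exact (hf V _ le_rfl a).trans (modules_map_self _ _ _)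
      rw [this]
      exact augDer_bijective V (hV V)
    have h₂ : IsIso (nilHomSections f V (Y.sec ⁻¹ᵁ V) le_rfl) :=
      (ConcreteCategory.isIso_iff_bijective _).mpr h₁
    have h₃ := nilToBase_preimage_le f (V := V) le_rfl
    have h₄ : nilHomLeft f ⁻¹ᵁ V ≤ nilToBase (augModule Y) ⁻¹ᵁ Y.sec ⁻¹ᵁ V := by
      rw [← nilHomLeft_toBase f, Scheme.Hom.comp_preimage, hV]
    have h₅ : (nilHomLeft f).appLE V _ h₃ ≫
        (nilScheme (augModule Y)).presheaf.map (homOfLE h₄).op = (nilHomLeft f).app V := by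
      rw [Scheme.Hom.appLE_map, Scheme.Hom.app_eq_appLE]
    have h₆ : IsIso ((nilHomLeft f).appLE V _ h₃) :=
      @IsIso.of_isIso_comp_right _ _ _ _ _ _ (nilSectionsAt (augModule Y) (Y.sec ⁻¹ᵁ V)) _ h₂
    have h₇ : homOfLE h₄ = eqToHom (le_antisymm h₄ h₃) := rfl
    rw [← h₅, h₇]
    infer_instance
  have hiso : IsIso (nilHomLeft f) := isIso_of_isIso_base_of_isIso_app _ hbase happ
  let g := inv (nilHomLeft f)
  have h₁ : g ≫ nilToBase (augModule Y) = Y.toBase :=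
    (IsIso.inv_comp_eq _).mpr (nilHomLeft_toBase f).symm
  have h₂ : Y.sec ≫ g = nilSection (augModule Y) :=
    (IsIso.comp_inv_eq _).mpr (nilSection_nilHomLeft f).symm
  exact ⟨⟨f, homOf (T := Y) (T' := nilPointed (augModule Y)) g h₁ h₂,
    PointedOver.hom_ext (IsIso.hom_inv_id (nilHomLeft f)),
    PointedOver.hom_ext (IsIso.inv_hom_id (nilHomLeft f))⟩⟩

end Reconstruction

/-! ### The equivalence of categories -/

section Equivalence

variable {X : Scheme.{u}}

lemma exists_nilPointed_iso_of_isSeparated (Y : PointedOver X) [IsSeparated Y.toBase]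
    [HasBinaryCoproduct Y Y] [AbCogroupObj Y] :
    ∃ F : Qcoh X, Nonempty (nilPointed F.obj ≅ Y) :=
  have : (augModule Y).IsQuasicoherent := isQuasicoherent_augModule Y
  ⟨⟨augModule Y, this⟩, exists_nilPointed_iso (sec_surjective Y) fun _ m n =>
    mul_eq_zero_of_sec_eq_zero Y _ _ (sec_app_eq_zero Y (augmentation_augVal m))
      (sec_app_eq_zero Y (augmentation_augVal n))⟩

instance hasBinaryCoproduct_nilFunctor (F : (Qcoh X)ᵒᵖ) :
    HasBinaryCoproduct ((nilFunctor X).obj F) ((nilFunctor X).obj F) :=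
  hasBinaryCoproduct_nilPointed F.unop.obj

instance abCogroupObjNilFunctor (F : (Qcoh X)ᵒᵖ) : AbCogroupObj ((nilFunctor X).obj F) :=
  nilAbCogroupObj F.unop.obj

lemma comul_map_nilFunctor {F G : (Qcoh X)ᵒᵖ} (φ : F ⟶ G) :
    AbCogroupObj.comul ≫ coprod.map ((nilFunctor X).map φ) ((nilFunctor X).map φ) =
      (nilFunctor X).map φ ≫ AbCogroupObj.comul := by
  let P := (nilFunctor X).obj
  have h₁ : (AbCogroupObj.comul : P F ⟶ P F ⨿ P F) = nilComul F.unop.obj := rfl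
  have h₂ : (AbCogroupObj.comul : P G ⟶ P G ⨿ P G) = nilComul G.unop.obj := rfl
  have h₃ : (coprod.map ((nilFunctor X).map φ) ((nilFunctor X).map φ) : P F ⨿ P F ⟶ P G ⨿ P G) =
    coprod.map (nilPointedMap φ.unop.hom) (nilPointedMap φ.unop.hom) := rfl
  have h₄ : ((nilFunctor X).map φ : P F ⟶ P G) = nilPointedMap φ.unop.hom := rfl
  exact (congr_arg₂ (fun (f : P F ⟶ P F ⨿ P F) (g : P F ⨿ P F ⟶ P G ⨿ P G) => f ≫ g) h₁ h₃).trans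
    ((nilComul_naturality φ.unop.hom).trans
      (congr_arg₂ (fun (f : P F ⟶ P G) (g : P G ⟶ P G ⨿ P G) => f ≫ g) h₄ h₂).symm)

/-- An isomorphism of abelian cogroup objects from a compatible isomorphism of the underlying
objects. -/
def abCogroupIso {C : Type w} [Category.{v} C] [HasInitial C] {Y Z : AbCogroup C}
    (e : Y.pt ≅ Z.pt)
    (h : AbCogroupObj.comul ≫ coprod.map e.hom e.hom = e.hom ≫ AbCogroupObj.comul) : Y ≅ Z where
  hom := ⟨e.hom, h⟩
  inv := ⟨e.inv, by
    rw [← cancel_epi e.hom, ← reassoc_of% h, coprod.map_map, e.hom_inv_id, coprod.map_id_id,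
      Category.comp_id, e.hom_inv_id_assoc]⟩
  hom_inv_id := AbCogroup.Hom.ext e.hom_inv_id
  inv_hom_id := AbCogroup.Hom.ext e.inv_hom_id

instance : (nilCogroupFunctor X comul_map_nilFunctor).Faithful where
  map_injective {F G φ ψ} h := by
    have h' : nilPointedMap φ.unop.hom = nilPointedMap ψ.unop.hom := congr(($h).hom.hom)
    exact Quiver.Hom.unop_inj (ObjectProperty.hom_ext _ (nilPointedMap_injective h'))

/-- Every morphism of the underlying pointed schemes is already some `Nil_X(φ)`. -/
instance : (nilCogroupFunctor X comul_map_nilFunctor).Full where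
  map_surjective {F G} f := by
    obtain ⟨φ, hφ⟩ := nilPointedMap_surjective (F := G.unop.obj) (G := F.unop.obj) f.hom.hom
    exact ⟨Quiver.Hom.op (ObjectProperty.homMk φ),
      ObjectProperty.hom_ext _ (AbCogroup.Hom.ext hφ)⟩

/-- The isomorphism obtained from the augmentation ideal is one of pointed schemes;
`nilComul_map_iso` upgrades it to cogroup objects. -/
instance : (nilCogroupFunctor X comul_map_nilFunctor).EssSurj where
  mem_essImage Y := by
    have : IsSeparated (PointedOver.toBase Y.obj.pt) := Y.property
    obtain ⟨F, ⟨e⟩⟩ := exists_nilPointed_iso_of_isSeparated Y.obj.pt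
    let e' : ((nilCogroupFunctor X comul_map_nilFunctor).obj (op F)).obj ≅ Y.obj :=
      abCogroupIso e (nilComul_map_iso e)
    exact ⟨op F, ⟨ObjectProperty.isoMk _ e'⟩⟩

end Equivalence

end AlgebraicGeometry

end

/-! ### The theorem for an `S`-scheme `X` -/

theorem mainTheorem5 {S : Scheme.{u}} (X : Over S) :
    ∃ (_ : ∀ F : (Qcoh X.left)ᵒᵖ,
        HasBinaryCoproduct ((nilFunctor X.left).obj F) ((nilFunctor X.left).obj F))
      (_ : ∀ F : (Qcoh X.left)ᵒᵖ, AbCogroupObj ((nilFunctor X.left).obj F)),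
      (∀ F : Qcoh X.left, ∃ _ : IsIso (nilComparison F),
        AbCogroupObj.comul = (nilFunctor X.left).map F.add.op ≫ inv (nilComparison F)) ∧
      (∀ F : Qcoh X.left, AbCogroupObj.antipode = (nilFunctor X.left).map F.neg.op) ∧
      ∃ h : ∀ {F G : (Qcoh X.left)ᵒᵖ} (φ : F ⟶ G),
        AbCogroupObj.comul ≫ coprod.map ((nilFunctor X.left).map φ) ((nilFunctor X.left).map φ) =
          (nilFunctor X.left).map φ ≫ AbCogroupObj.comul,
        (nilCogroupFunctor X.left h).IsEquivalence :=
  -- The comultiplication and the antipode were defined by the required formulas, so these hold by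
  -- `rfl`; `{}` collects the instances for faithful, full and essentially surjective.
  ⟨hasBinaryCoproduct_nilFunctor, abCogroupObjNilFunctor,
    fun F => ⟨inferInstanceAs (IsIso (nilCoprodDesc F.obj)), rfl⟩, fun _ => rfl,
    comul_map_nilFunctor, {}⟩
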